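/- **Setting.** Let $\Sigma$ be a non-empty finite alphabet, $\mathfrak D$ an infinite set of data values and $m\ge 0$. A data word is a finite sequence $w=w_1\ldots w_n$ over $\Sigma\times\mathfrak D^m$; position $i$ has a label $\ell(i)\in\Sigma$ and data values $d^1(i),\ldots,d^m(i)$. A signature $\mathscr S$ consists of a finite set $\sigma$ of binary relation symbols ($|\mathscr S|:=|\sigma|$; we write $\lhd\in\mathscr S$ for $\lhd\in\sigma$) and an interpretation that assigns to each $\lhd\in\sigma$ and each data word $w$ of length $n$ a relation $\lhd^w\subseteq[n]\times[n]$ which is contained in $<$, has out-degree and in-degree at most one, and is monotone: if $i\lhd^w j$, $i'\lhd^w j'$, $w_i=w_{i'}$ and $w_j=w_{j'}$, then $i<i'$ iff $j<j'$. Write $\mathrm{prev}_\lhd(i)$ and $\mathrm{next}_\lhd(i)$ for the $\lhd^w$-predecessor and $\lhd^w$-successor of $i$, if defined. An $\mathscr S$-graph is a finite set of nodes with, for each $\lhd\in\mathscr S$, an edge relation of out-degree and in-degree at most one, and with each node labelled by a letter of $\Sigma$ and a partition of $[m]$. Distances are taken in the undirected graph formed by all edges. The $B$-sphere around a node is the substructure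 induced by the nodes at distance at most $B$, with the node as distinguished center. $B\text{-}\mathit{Spheres}$ is the finite set of isomorphism types of $B$-spheres in $\mathscr S$-graphs. A data word $w$ induces the $\mathscr S$-graph $([n],(\lhd^w)_{\lhd},\ell,\nu)$ in which $k,l\in[m]$ are in the same class of $\nu(i)$ iff $d^k(i)=d^l(i)$; $\mathit{dist}^w$ and $B\text{-}\mathit{Sph}^w(i)$ refer to this graph. A class register automaton over $\mathscr S$ is a tuple $(Q,R,\Delta,(F_\lhd)_{\lhd\in\mathscr S},\Phi)$ with finite sets $Q$ of states and $R$ of registers, sets $F_\lhd\subseteq Q$, a boolean formula $\Phi$ over atoms $q\le N$ ($q\in Q$, $N\in\mathbb N$), and a finite set $\Delta$ of transitions $(p,g)\xrightarrow{a}(q,f)$, where $p:\mathscr S\rightharpoonup Q$, $g$ is a boolean formula over atoms $\theta_1=\theta_2$ with $\theta_1,\theta_2\in[m]\cup(\mathrm{dom}(p)\times R)$, $a\in\Sigma$, $q\in Q$, and $f:R\rightharpoonup(\mathrm{dom}(p)\times R)\cup([m]\times\mathbb N)$. A run on $w=w_1\ldots w_n$ is a sequence $(q_1,\rho_1)\ldots(q_n,\rho_n)$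 with $q_i\in Q$ and $\rho_i:R\rightharpoonup\mathfrak D$ such that for each $i$ there is a transition $(p,g)\xrightarrow{\ell(i)}(q_i,f)$ in $\Delta$ for which: $\mathrm{dom}(p)$ is the set of $\lhd$ such that $\mathrm{prev}_\lhd(i)$ is defined, and $p(\lhd)=q_{\mathrm{prev}_\lhd(i)}$ for these; $g$ is true, where $k\in[m]$ has value $d^k(i)$, $(\lhd,r)$ has value $\rho_{\mathrm{prev}_\lhd(i)}(r)$, and $\theta_1=\theta_2$ holds iff both values are defined and equal; and, for each $r\in R$, $\rho_i(r)=\rho_{\mathrm{prev}_\lhd(i)}(r')$ if $f(r)=(\lhd,r')$, $\rho_i(r)\in\{d^k(j)\mid \mathit{dist}^w(i,j)\le b\}$ if $f(r)=(k,b)$, and $\rho_i(r)$ is undefined if $f(r)$ is. The run is accepting if $q_i\in F_\lhd$ whenever $\mathrm{next}_\lhd(i)$ is undefined, and $\Phi$ holds, where $q\le N$ means that $q$ occurs at most $N$ times in the run. $L(\mathcal A)$ is the set of data words that admit an accepting run. A quantity is elementary in $n$ if it is bounded by a tower $2^{2^{\cdot^{\cdot^{2^n}}}}$ of some fixed height,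 and elementary in several numbers if it is elementary in their sum. **Proposition.** There is an algorithm that, given $B\in\mathbb N$, $|\mathscr S|$, $|\Sigma|\ge 1$ and $m$, computes, in time elementary in these numbers, (explicit descriptions of) a class register automaton $\mathcal A_B=(Q,R,\Delta,(F_\lhd)_{\lhd\in\mathscr S},\mathit{true})$ over $\mathscr S$ and a mapping $\pi:Q\to B\text{-}\mathit{Spheres}$ such that, for every infinite set $\mathfrak D$ and every interpretation of the relation symbols, 1. $L(\mathcal A_B)=(\Sigma\times\mathfrak D^m)^*$, and 2. for every data word $w=w_1\ldots w_n$, every accepting run $(q_1,\rho_1)\ldots(q_n,\rho_n)$ of $\mathcal A_B$ on $w$ and every $i\in[n]$, $\pi(q_i)\cong B\text{-}\mathit{Sph}^w(i)$. Moreover, $|Q|$ and $|R|$ are elementary in $B$, $|\mathscr S|$, $|\Sigma|$ and $m$; in particular, for fixed $\Sigma$ and $m$, they are elementary in $B$ and $|\mathscr S|$. -/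

import Mathlib

/-!
Data words, signatures, spheres, class register automata, finite descriptions of automata
as lists of numbers, and elementary-time computation.
-/

/-! ### Data words and signatures -/

/-- Data words over the label alphabet `Λ`, with `m` data values from `D` at each position. -/
abbrev DataWord (Λ D : Type*) (m : ℕ) := List (Λ × (Fin m → D))

/-- An interpretation of the set `σ` of binary relation symbols on the positions of all data
words (over `Λ`, `D`, `m`); together with `σ` this is a signature. -/
structure Signature (Λ D σ : Type*) (m : ℕ) where
  rel : (w : DataWord Λ D m) → σ → Fin w.length → Fin w.length → Prop
  lt_of_rel : ∀ (w : DataWord Λ D m) (x : σ) (i j : Fin w.length), rel w x i j → i < j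
  out_unique : ∀ (w : DataWord Λ D m) (x : σ) (i j k : Fin w.length),
    rel w x i j → rel w x i k → j = k
  in_unique : ∀ (w : DataWord Λ D m) (x : σ) (i j k : Fin w.length),
    rel w x j i → rel w x k i → j = k
  monotone : ∀ (w : DataWord Λ D m) (x : σ) (i j i' j' : Fin w.length),
    rel w x i j → rel w x i' j' → w.get i = w.get i' → w.get j = w.get j' → (i < i' ↔ j < j')

/-! ### Graphs and spheres -/

/-- `σ`-edge-labelled graphs with node set `V`, each node carrying a letter from `Λ` and a
partition of the `m` data indices (given as the equivalence relation with these classes);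
every edge relation has out-degree and in-degree at most one. -/
structure SGraph (Λ σ : Type*) (m : ℕ) (V : Type*) where
  edge : σ → V → V → Prop
  label : V → Λ
  part : V → Setoid (Fin m)
  out_unique : ∀ (x : σ) (i j k : V), edge x i j → edge x i k → j = k
  in_unique : ∀ (x : σ) (i j k : V), edge x j i → edge x k i → j = k

/-- Graphs with a distinguished node, the center. -/
structure PointedGraph (Λ σ : Type*) (m : ℕ) (V : Type*) extends SGraph Λ σ m V where
  center : V

/-- The underlying undirected graph; all edge relations and their inverses are joined.
Loops are irrelevant for distances. -/
def SGraph.undirected {Λ σ V : Type*} {m : ℕ} (G : SGraph Λ σ m V) : SimpleGraph V :=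
  SimpleGraph.fromRel (fun u v => ∃ x, G.edge x u v)

/-- `dist(i, j) ≤ B`; this fails if there is no path from `i` to `j`. -/
def SGraph.DistLE {Λ σ V : Type*} {m : ℕ} (G : SGraph Λ σ m V) (B : ℕ) (i j : V) : Prop :=
  G.undirected.edist i j ≤ (B : ℕ∞)

/-- The `B`-sphere of `G` around `i`: the substructure induced by the nodes at distance at most
`B` from `i`, with center `i`. -/
def SGraph.sphere {Λ σ V : Type*} {m : ℕ} (G : SGraph Λ σ m V) (B : ℕ) (i : V) :
    PointedGraph Λ σ m {j : V // G.DistLE B i j} where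
  edge x u v := G.edge x u.1 v.1
  label u := G.label u.1
  part u := G.part u.1
  out_unique x u v w h h' := Subtype.ext (G.out_unique x u.1 v.1 w.1 h h')
  in_unique x u v w h h' := Subtype.ext (G.in_unique x u.1 v.1 w.1 h h')
  center := ⟨i, by simp [SGraph.DistLE]⟩

/-- Isomorphism of pointed graphs. -/
def PointedGraph.Iso {Λ σ V W : Type*} {m : ℕ}
    (S : PointedGraph Λ σ m V) (T : PointedGraph Λ σ m W) : Prop :=
  ∃ e : V ≃ W, (∀ x u v, S.edge x u v ↔ T.edge x (e u) (e v)) ∧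
    (∀ u, S.label u = T.label (e u)) ∧ (∀ u, S.part u = T.part (e u)) ∧
    e S.center = T.center

/-- `S` is (isomorphic to) the `B`-sphere around some node of some finite graph. -/
def PointedGraph.IsSphere {Λ σ V : Type*} {m : ℕ} (B : ℕ) (S : PointedGraph Λ σ m V) : Prop :=
  ∃ (W : Type) (_ : Finite W) (G : SGraph Λ σ m W) (i : W), S.Iso (G.sphere B i)

/-- Finite pointed graphs on node sets `{0, …, N-1}`: concrete representatives of finite pointed
graphs up to isomorphism. -/
abbrev FinPointedGraph (Λ σ : Type*) (m : ℕ) := Σ N : ℕ, PointedGraph Λ σ m (Fin N)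

/-- The graph of a data word: nodes are the positions, and two indices are in the same class at
position `i` iff they carry the same data value at `i`. -/
def Signature.graph {Λ D σ : Type*} {m : ℕ} (I : Signature Λ D σ m) (w : DataWord Λ D m) :
    SGraph Λ σ m (Fin w.length) where
  edge x i j := I.rel w x i j
  label i := (w.get i).1
  part i := Setoid.ker (w.get i).2
  out_unique := I.out_unique w
  in_unique := I.in_unique w

/-! ### Boolean formulas -/

/-- Boolean formulas over a set of atoms. -/
inductive BoolFormula (α : Type*) where
  | tru : BoolFormula α
  | fls : BoolFormula α
  | atom (a : α) : BoolFormula α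
  | neg (β : BoolFormula α) : BoolFormula α
  | or (β γ : BoolFormula α) : BoolFormula α
  | and (β γ : BoolFormula α) : BoolFormula α

/-- Truth of a boolean formula under an assignment of truth values to the atoms. -/
def BoolFormula.Eval {α : Type*} (v : α → Prop) : BoolFormula α → Prop
  | .tru => True
  | .fls => False
  | .atom a => v a
  | .neg β => ¬ β.Eval v
  | .or β γ => β.Eval v ∨ γ.Eval v
  | .and β γ => β.Eval v ∧ γ.Eval v

/-- The atoms that occur in a boolean formula. -/
def BoolFormula.atoms {α : Type*} : BoolFormula α → Set α
  | .tru => ∅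
  | .fls => ∅
  | .atom a => {a}
  | .neg β => β.atoms
  | .or β γ => β.atoms ∪ γ.atoms
  | .and β γ => β.atoms ∪ γ.atoms

/-! ### Class register automata -/

/-- Terms of guards: the `k`-th current data value, or the entry of register `r` at the
`x`-predecessor of the current position. -/
inductive GuardTerm (σ R : Type*) (m : ℕ) where
  | cur (k : Fin m) : GuardTerm σ R m
  | reg (x : σ) (r : R) : GuardTerm σ R m

/-- Register updates: copy the entry of register `r` at the `x`-predecessor, or guess some
`k`-th data value from the `b`-sphere around the current position. -/
inductive RegUpdate (σ R : Type*) (m : ℕ) where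
  | copy (x : σ) (r : R) : RegUpdate σ R m
  | guess (k : Fin m) (b : ℕ) : RegUpdate σ R m

/-- Transitions `(p, g) --a--> (q, f)`: `src` is the partial map `p`, `guard` is `g` (an atom
`(θ₁, θ₂)` stands for `θ₁ = θ₂`), `letter` is `a`, `tgt` is `q`, and `upd` is the partial
map `f`. -/
structure CRATransition (Λ σ Q R : Type*) (m : ℕ) where
  src : σ → Option Q
  guard : BoolFormula (GuardTerm σ R m × GuardTerm σ R m)
  letter : Λ
  tgt : Q
  upd : R → Option (RegUpdate σ R m)

/-- A term refers to an `x`-predecessor only if `x` is in the domain of `p`. -/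
def GuardTerm.InDom {σ Q R : Type*} {m : ℕ} (p : σ → Option Q) : GuardTerm σ R m → Prop
  | .cur _ => True
  | .reg x _ => (p x).isSome

/-- An update refers to an `x`-predecessor only if `x` is in the domain of `p`. -/
def RegUpdate.InDom {σ Q R : Type*} {m : ℕ} (p : σ → Option Q) : RegUpdate σ R m → Prop
  | .copy x _ => (p x).isSome
  | .guess _ _ => True

/-- Guards and updates refer to predecessors in the domain of the source map only. -/
def CRATransition.WellFormed {Λ σ Q R : Type*} {m : ℕ} (t : CRATransition Λ σ Q R m) : Prop :=
  (∀ e ∈ t.guard.atoms, e.1.InDom t.src ∧ e.2.InDom t.src) ∧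
    ∀ r u, t.upd r = some u → u.InDom t.src

/-- Class register automata with state set `Q` and register set `R` (finite sets in all uses).
`trans` lists the finite set of transitions, `locFinal` are the sets of local final states, and
`acc` is the global acceptance condition, where the atom `(q, N)` stands for `q ≤ N`. -/
structure CRA (Λ σ Q R : Type*) (m : ℕ) where
  trans : List (CRATransition Λ σ Q R m)
  wf : ∀ t ∈ trans, t.WellFormed
  locFinal : σ → Set Q
  acc : BoolFormula (Q × ℕ)

/-- Sequences of configurations (state and partial register contents), one for each position
of `w`. -/
abbrev ConfigSeq {Λ D : Type*} {m : ℕ} (Q R : Type*) (w : DataWord Λ D m) :=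
  Fin w.length → Q × (R → Option D)

/-- `TermVal I w ξ i θ d`: the value of the term `θ` at position `i` is defined and equals
`d`. -/
def TermVal {Λ D σ Q R : Type*} {m : ℕ} (I : Signature Λ D σ m) (w : DataWord Λ D m)
    (ξ : ConfigSeq Q R w) (i : Fin w.length) : GuardTerm σ R m → D → Prop
  | .cur k, d => (w.get i).2 k = d
  | .reg x r, d => ∃ j, I.rel w x j i ∧ (ξ j).2 r = some d

/-- `UpdateOK I w ξ i u v`: the update `u` allows a register to have contents `v` at
position `i`. -/
def UpdateOK {Λ D σ Q R : Type*} {m : ℕ} (I : Signature Λ D σ m) (w : DataWord Λ D m)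
    (ξ : ConfigSeq Q R w) (i : Fin w.length) : Option (RegUpdate σ R m) → Option D → Prop
  | none, v => v = none
  | some (.copy x r), v => ∃ j, I.rel w x j i ∧ v = (ξ j).2 r
  | some (.guess k b), v => ∃ j, (I.graph w).DistLE b i j ∧ v = some ((w.get j).2 k)

/-- The transition `t` can be executed at position `i` in the sequence `ξ`. -/
def CRATransition.ExecAt {Λ D σ Q R : Type*} {m : ℕ} (t : CRATransition Λ σ Q R m)
    (I : Signature Λ D σ m) (w : DataWord Λ D m) (ξ : ConfigSeq Q R w)
    (i : Fin w.length) : Prop :=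
  t.letter = (w.get i).1 ∧ t.tgt = (ξ i).1 ∧
    (∀ x, (t.src x).isSome ↔ ∃ j, I.rel w x j i) ∧
    (∀ x j, I.rel w x j i → t.src x = some (ξ j).1) ∧
    t.guard.Eval (fun e => ∃ d, TermVal I w ξ i e.1 d ∧ TermVal I w ξ i e.2 d) ∧
    ∀ r, UpdateOK I w ξ i (t.upd r) ((ξ i).2 r)

/-- `ξ` is a run of `A` on `w`. -/
def CRA.IsRun {Λ D σ Q R : Type*} {m : ℕ} (A : CRA Λ σ Q R m) (I : Signature Λ D σ m)
    (w : DataWord Λ D m) (ξ : ConfigSeq Q R w) : Prop :=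
  ∀ i, ∃ t ∈ A.trans, t.ExecAt I w ξ i

/-- `ξ` is an accepting run of `A` on `w`. -/
def CRA.IsAcceptingRun {Λ D σ Q R : Type*} {m : ℕ} (A : CRA Λ σ Q R m) (I : Signature Λ D σ m)
    (w : DataWord Λ D m) (ξ : ConfigSeq Q R w) : Prop :=
  A.IsRun I w ξ ∧
    (∀ i x, (¬ ∃ j, I.rel w x i j) → (ξ i).1 ∈ A.locFinal x) ∧
    A.acc.Eval (fun c => {i | (ξ i).1 = c.1}.ncard ≤ c.2)

/-- The language of `A`: all data words that admit an accepting run. -/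
def CRA.language {Λ D σ Q R : Type*} {m : ℕ} (A : CRA Λ σ Q R m) (I : Signature Λ D σ m) :
    Set (DataWord Λ D m) :=
  {w | ∃ ξ : ConfigSeq Q R w, A.IsAcceptingRun I w ξ}

/-! ### Explicit descriptions as lists of numbers

All items are prefix codes, so a description determines the described object once the numbers
`s`, `a`, `m` of relation symbols, letters and data values per position are known. -/

open Classical in
/-- The truth value of a proposition as a bit. -/
noncomputable def bitOf (p : Prop) : ℕ := if p then 1 else 0

/-- Boolean formulas in prefix notation. -/
def BoolFormula.tokens {α : Type*} (f : α → List ℕ) : BoolFormula α → List ℕ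
  | .tru => [0]
  | .fls => [1]
  | .atom a => 2 :: f a
  | .neg β => 3 :: β.tokens f
  | .or β γ => 4 :: (β.tokens f ++ γ.tokens f)
  | .and β γ => 5 :: (β.tokens f ++ γ.tokens f)

def GuardTerm.tokens {s nR m : ℕ} : GuardTerm (Fin s) (Fin nR) m → List ℕ
  | .cur k => [0, k]
  | .reg x r => [1, x, r]

def updateTokens {s nR m : ℕ} : Option (RegUpdate (Fin s) (Fin nR) m) → List ℕ
  | none => [0]
  | some (.copy x r) => [1, x, r]
  | some (.guess k b) => [2, k, b]

def sourceToken {nQ : ℕ} : Option (Fin nQ) → ℕ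
  | none => 0
  | some q => q + 1

/-- The source map, the guard, the letter, the target state, and the update map. -/
def CRATransition.tokens {a s nQ nR m : ℕ}
    (t : CRATransition (Fin a) (Fin s) (Fin nQ) (Fin nR) m) : List ℕ :=
  (List.finRange s).map (fun x => sourceToken (t.src x)) ++
    t.guard.tokens (fun e => e.1.tokens ++ e.2.tokens) ++
    [(t.letter : ℕ), (t.tgt : ℕ)] ++
    (List.finRange nR).flatMap (fun r => updateTokens (t.upd r))

/-- The numbers of states, registers and transitions, all transitions, the table of the local
final states, and the global acceptance condition. -/
noncomputable def CRA.tokens {a s nQ nR m : ℕ}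
    (A : CRA (Fin a) (Fin s) (Fin nQ) (Fin nR) m) : List ℕ :=
  [nQ, nR, A.trans.length] ++ A.trans.flatMap CRATransition.tokens ++
    (List.finRange s).flatMap
      (fun x => (List.finRange nQ).map (fun q => bitOf (q ∈ A.locFinal x))) ++
    A.acc.tokens (fun c => [(c.1 : ℕ), c.2])

/-- The number of nodes, the center, the adjacency tables, the labels, and the tables of the
equivalence relations that represent the partitions. -/
noncomputable def FinPointedGraph.tokens {a s m : ℕ}
    (S : FinPointedGraph (Fin a) (Fin s) m) : List ℕ :=
  [S.1, (S.2.center : ℕ)] ++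
    (List.finRange s).flatMap (fun x => (List.finRange S.1).flatMap (fun u =>
      (List.finRange S.1).map (fun v => bitOf (S.2.edge x u v)))) ++
    (List.finRange S.1).map (fun u => (S.2.label u : ℕ)) ++
    (List.finRange S.1).flatMap (fun u => (List.finRange m).flatMap (fun k =>
      (List.finRange m).map (fun l => bitOf ((S.2.part u).r k l))))

/-- The description of an automaton followed by the table of a map from its states to finite
pointed graphs. -/
noncomputable def descriptionTokens {a s nQ nR m : ℕ}
    (A : CRA (Fin a) (Fin s) (Fin nQ) (Fin nR) m)
    (π : Fin nQ → FinPointedGraph (Fin a) (Fin s) m) : List ℕ :=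
  A.tokens ++ (List.finRange nQ).flatMap (fun q => FinPointedGraph.tokens (π q))

/-! ### Elementary-time computation -/

/-- The program `c`, started on the list `input`, halts with the list `output` after at most `t`
steps of the abstract machine `Turing.ToPartrec.step`. In one step of that machine numbers grow
by at most one, and the configurations reached in `t` steps have size polynomial in `t` and the
size (in unary) of the input; so this time is polynomially related to the time of Turing
machines that store numbers in unary. -/
def ComputesInTime (c : Turing.ToPartrec.Code) (input output : List ℕ) (t : ℕ) : Prop :=
  Nonempty (StateTransition.EvalsToInTime Turing.ToPartrec.step
    (Turing.ToPartrec.stepNormal c Turing.ToPartrec.Cont.halt input)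
    (some (Turing.ToPartrec.Cfg.halt output)) t)

/-- `tower h n` is the tower `2 ^ (2 ^ ⋯ (2 ^ n))` with `h` twos. A quantity is elementary in `n`
if it is at most `tower h n` for some fixed `h`. -/
def tower : ℕ → ℕ → ℕ
  | 0, n => n
  | h + 1, n => 2 ^ tower h n

/-!
The automaton guesses, at every position `i` of a word, the spheres around all positions at
distance at most `B` from `i`, and verifies its guesses locally.

**States.** Colour the positions so that distinct positions at distance at most `4 * B + 1` have
distinct colours. Since every position has at most `2 * s` neighbours, `(2 * s + 1) ^ (4 * B + 1)`
colours suffice (`card_ball_le`, `exists_greedy`). Nodes of a sphere are then named by their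
colours, and a sphere is a table of levels, letters, partitions and successors, written as the
digits of a number (`Par.lev`, `Par.lab`, `Par.cls`, `Par.out`). A state consists of the own
colour and, for every colour `γ`, the sphere of the `γ`-coloured position within distance `B`, if
there is one. There is a register for every colour `α` and every index `k`; it holds the `k`-th
data value of the `α`-coloured position nearby. The sphere attached to a state is the one of its
own colour.

**Correctness.** Colours need not be proper in an arbitrary accepting run. Let `S` be the sphere
at `i`, and for a node `α` of `S` let `X α` be the set of positions that claim to be the node `α`
of `S` and hold the same registers for the nodes of `S` as `i` does (`Par.Claims`). All positions
in `X α` carry the same letter and the same data values, so following an edge from `α` to `β` is a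
monotone bijection from `X α` to `X β`. It therefore preserves the rank of a position in these
finite sets (`Par.Consistent.rank_eq`). As `S` is connected, each `X α` has a unique element of
the rank of `i`, and these elements form the sphere around `i` (`Par.Consistent.iso_sphere`).
Conversely, the true spheres of any word form an accepting run (`Par.exists_acceptingRun`).

**Complexity.** Every pair of a state and a source map is listed as a transition; the guard of a
transition whose states do not fit together is the constant `false`. What remains is to print the
tables, and all entries are given by Kalmár elementary functions and predicates of numbers: these
are closed under arithmetic, bounded sums and products and bounded quantifiers. `Elem` and `Emits`
say that such a function is computed, respectively that a list is printed, within a time that is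
bounded by a tower of exponentials in the arguments, and `exists_code` is the resulting program.
-/

namespace SphereCRA

open Turing.ToPartrec

/-! ### Growth bounds by towers -/

theorem tower_mono (h : ℕ) {x y : ℕ} (hxy : x ≤ y) : tower h x ≤ tower h y := by
  induction h with
  | zero => exact hxy
  | succ h ih => exact Nat.pow_le_pow_right (by norm_num) ih

theorem tower_tower (h h' n : ℕ) : tower h (tower h' n) = tower (h + h') n := by
  induction h with
  | zero => simp [tower]
  | succ h ih => rw [Nat.add_right_comm]; simp [tower, ih]

theorem le_tower (h n : ℕ) : n ≤ tower h n := by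
  induction h with
  | zero => exact le_rfl
  | succ h ih => exact ih.trans Nat.lt_two_pow_self.le

theorem tower_le_tower {h h' : ℕ} (hh : h ≤ h') (n : ℕ) : tower h n ≤ tower h' n := by
  obtain ⟨d, rfl⟩ := Nat.exists_eq_add_of_le' hh
  rw [← tower_tower]
  exact le_tower _ _

theorem height_le_tower (h n : ℕ) : h ≤ tower h n := by
  induction h with
  | zero => exact Nat.zero_le _
  | succ h ih => exact (Nat.succ_le_succ ih).trans Nat.lt_two_pow_self

theorem two_mul_le_two_pow (n : ℕ) : 2 * n ≤ 2 ^ n := by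
  cases n with
  | zero => simp
  | succ n =>
    have := Nat.lt_two_pow_self (n := n)
    rw [pow_succ]; omega

/-- The quantity `f` is elementary in the size measure `μ`. -/
def TowerBounded {ι : Type*} (μ f : ι → ℕ) : Prop := ∃ h, ∀ v, f v ≤ tower h (μ v)

namespace TowerBounded

variable {ι κ : Type*} {μ f g : ι → ℕ}

theorem mono (hg : TowerBounded μ g) (hfg : ∀ v, f v ≤ g v) : TowerBounded μ f :=
  let ⟨h, hh⟩ := hg
  ⟨h, fun v => (hfg v).trans (hh v)⟩

theorem self : TowerBounded μ μ := ⟨0, fun _ => le_rfl⟩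

theorem const (n : ℕ) : TowerBounded μ (fun _ => n) := ⟨n, fun _ => height_le_tower _ _⟩

theorem comp {ν : κ → ℕ} {f : κ → ℕ} (hf : TowerBounded ν f) (j : ι → κ)
    (hj : TowerBounded μ (fun v => ν (j v))) : TowerBounded μ (fun v => f (j v)) := by
  obtain ⟨h, hh⟩ := hf
  obtain ⟨h', hh'⟩ := hj
  refine ⟨h + h', fun v => (hh _).trans ?_⟩
  rw [← tower_tower]
  exact tower_mono _ (hh' v)

/-- One height of the tower serves for two quantities. -/
theorem exists_common (hf : TowerBounded μ f) (hg : TowerBounded μ g) :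
    ∃ h, (∀ v, f v ≤ tower h (μ v)) ∧ ∀ v, g v ≤ tower h (μ v) := by
  obtain ⟨h, hh⟩ := hf
  obtain ⟨h', hh'⟩ := hg
  exact ⟨max h h', fun v => (hh v).trans (tower_le_tower (le_max_left _ _) _),
    fun v => (hh' v).trans (tower_le_tower (le_max_right _ _) _)⟩

theorem add (hf : TowerBounded μ f) (hg : TowerBounded μ g) :
    TowerBounded μ (fun v => f v + g v) := by
  obtain ⟨h, h₁, h₂⟩ := exists_common hf hg
  refine ⟨h + 1, fun v => ?_⟩
  have := two_mul_le_two_pow (tower h (μ v))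
  have := h₁ v
  have := h₂ v
  simp only [tower]
  omega

theorem two_pow (hf : TowerBounded μ f) : TowerBounded μ (fun v => 2 ^ f v) := by
  obtain ⟨h, hh⟩ := hf
  exact ⟨h + 1, fun v => Nat.pow_le_pow_right (by norm_num) (hh v)⟩

theorem mul (hf : TowerBounded μ f) (hg : TowerBounded μ g) :
    TowerBounded μ (fun v => f v * g v) := by
  refine (hf.add hg).two_pow.mono fun v => ?_
  rw [pow_add]
  exact Nat.mul_le_mul Nat.lt_two_pow_self.le Nat.lt_two_pow_self.le

theorem pow (hf : TowerBounded μ f) (hg : TowerBounded μ g) :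
    TowerBounded μ (fun v => f v ^ g v) := by
  refine (hf.mul hg).two_pow.mono fun v => ?_
  rw [pow_mul]
  exact Nat.pow_le_pow_left Nat.lt_two_pow_self.le _

end TowerBounded

/-! ### Timed evaluation of programs -/

/-- The machine reaches the configuration `y` from `x` in at most `t` steps. -/
def Reach (x y : Cfg) (t : ℕ) : Prop := ∃ n ≤ t, (flip bind step)^[n] (some x) = some y

theorem Reach.trans {x y z : Cfg} {t u : ℕ} (h₁ : Reach x y t) (h₂ : Reach y z u) :
    Reach x z (t + u) := by
  obtain ⟨n, hn, h₁⟩ := h₁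
  obtain ⟨k, hk, h₂⟩ := h₂
  exact ⟨k + n, by omega, by rw [Function.iterate_add_apply, h₁, h₂]⟩

theorem Reach.mono {x y : Cfg} {t u : ℕ} (h : Reach x y t) (htu : t ≤ u) : Reach x y u :=
  let ⟨n, hn, h⟩ := h
  ⟨n, hn.trans htu, h⟩

theorem Reach.ret (k : Cont) (v : List ℕ) : Reach (Cfg.ret k v) (stepRet k v) 1 :=
  ⟨1, le_rfl, rfl⟩

/-- In every continuation `k`, the program `c` turns the list `v` into the list `w` in at most `t`
steps. The target `stepRet k w` is the configuration in which `k` has received `w`; it composes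
better than `Cfg.ret k w`, one step earlier. -/
def Runs (c : Code) (v w : List ℕ) (t : ℕ) : Prop :=
  ∀ k, Reach (stepNormal c k v) (stepRet k w) t

namespace Runs

variable {f g : Code} {u v w : List ℕ} {n t t' : ℕ}

theorem mono (h : Runs f v w t) (ht : t ≤ t') : Runs f v w t' := fun k => (h k).mono ht

theorem zero' : Runs Code.zero' v (0 :: v) 1 := fun k => Reach.ret k _

theorem succ : Runs Code.succ (n :: v) [n + 1] 1 := fun k => Reach.ret k _

theorem tail : Runs Code.tail v v.tail 1 := fun k => Reach.ret k _

theorem comp (hg : Runs g v u t) (hf : Runs f u w t') : Runs (f.comp g) v w (t + t') :=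
  fun k => (hg (Cont.comp f k)).trans (hf k)

theorem cons (hf : Runs f v u t) (hg : Runs g v w t') :
    Runs (f.cons g) v (u.headI :: w) (t + t') :=
  fun k => (hf (Cont.cons₁ g v k)).trans (hg (Cont.cons₂ u k))

theorem case_zero (hf : Runs f v w t) : Runs (f.case g) (0 :: v) w t := hf

theorem case_succ (hg : Runs g (n :: v) w t) : Runs (f.case g) ((n + 1) :: v) w t := hg

theorem fix_stop (hf : Runs f v (0 :: w) t) : Runs f.fix v w t :=
  fun k => hf (Cont.fix f k)

theorem fix_continue (hf : Runs f v ((n + 1) :: u) t) (h : Runs f.fix u w t') :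
    Runs f.fix v w (t + t') :=
  fun k => (hf (Cont.fix f k)).trans (h k)

theorem id : Runs (Code.tail.comp Code.zero') v v 2 := zero'.comp tail

end Runs

/-- The program that prepends the number `1`. -/
def one' : Code := (Code.succ.comp Code.zero').cons (Code.tail.comp Code.zero')

theorem Runs.one' {v : List ℕ} : Runs one' v (1 :: v) 4 :=
  (Runs.zero'.comp Runs.succ).cons Runs.id

/-- `tails n` drops the first `n` entries. -/
def tails : ℕ → Code
  | 0 => Code.tail.comp Code.zero'
  | n + 1 => (tails n).comp Code.tail

theorem Runs.tails (n : ℕ) (v : List ℕ) : Runs (tails n) v (v.drop n) (n + 2) := by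
  induction n generalizing v with
  | zero => exact Runs.id
  | succ n ih =>
    have := Runs.tail.comp (ih v.tail)
    rw [List.drop_tail] at this
    exact this.mono (by omega)

/-- Run `c` once for each value `n - 1, …, 0` of a counter at the head of the list. -/
def loopCode (c : Code) : Code := (Code.zero'.case (one'.comp c)).fix

/-- `st n` is the memory behind the counter when `n` rounds remain. -/
theorem Runs.loop {c : Code} {N M : ℕ} {st : ℕ → List ℕ}
    (h : ∀ n < N, Runs c (n :: st (n + 1)) (n :: st n) M) :
    Runs (loopCode c) (N :: st N) (st 0) ((N + 1) * (M + 4)) := by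
  have key : ∀ n ≤ N, Runs (loopCode c) (n :: st n) (st 0) ((n + 1) * (M + 4)) := by
    intro n
    induction n with
    | zero =>
      intro _
      exact (Runs.fix_stop (Runs.case_zero Runs.zero')).mono (by omega)
    | succ n ih =>
      intro hn
      refine (Runs.fix_continue (Runs.case_succ ((h n hn).comp Runs.one'))
        (ih (by omega))).mono ?_
      rw [Nat.add_mul (n + 1) 1]
      omega
  exact key N le_rfl

/-! ### Elementary functions -/

/-- Types whose elements are kept in memory as a block of numbers of fixed length. The pairs
`ℕ × α` are environments with one more bound variable. -/
class Env (α : Type) where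
  toList : α → List ℕ
  len : ℕ
  length_toList : ∀ v, (toList v).length = len

instance {α : Type} [Env α] : Env (ℕ × α) where
  toList v := v.1 :: Env.toList v.2
  len := Env.len α + 1
  length_toList v := by simp [Env.length_toList]

/-- The size of a block is the sum of its entries. -/
def size {α : Type} [Env α] (v : α) : ℕ := (Env.toList v).sum

theorem size_cons {α : Type} [Env α] (v : ℕ × α) : size v = v.1 + size v.2 := by
  simp [size, Env.toList]

variable {α : Type} [Env α]

/-- Functions with elementary values that are computed in elementary time. The program
must not depend on what follows the block of arguments in memory. -/
def Elem (f : α → ℕ) : Prop :=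
  ∃ (c : Code) (T : α → ℕ), TowerBounded size T ∧ TowerBounded size f ∧
    ∀ v acc, ∃ r, Runs c (Env.toList v ++ acc) (f v :: r) (T v)

namespace Elem

variable {f g : α → ℕ}

theorem towerBounded (hf : Elem f) : TowerBounded size f :=
  let ⟨_, _, _, h, _⟩ := hf
  h

theorem succ (hf : Elem f) : Elem (fun v => f v + 1) := by
  obtain ⟨c, T, hT, hf, hc⟩ := hf
  refine ⟨Code.succ.comp c, _, hT.add (.const 1), hf.add (.const 1), fun v acc => ?_⟩
  obtain ⟨r, hr⟩ := hc v acc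
  exact ⟨[], hr.comp Runs.succ⟩

theorem const (n : ℕ) : Elem (fun _ : α => n) := by
  induction n with
  | zero =>
    exact ⟨Code.zero', fun _ => 1, .const 1, .const 0, fun v acc => ⟨_, Runs.zero'⟩⟩
  | succ n ih => exact ih.succ

theorem fst : Elem (fun v : ℕ × α => v.1) :=
  ⟨Code.tail.comp Code.zero', fun _ => 2, .const 2,
    TowerBounded.self.mono fun v => by rw [size_cons]; omega, fun v acc => ⟨_, Runs.id⟩⟩

theorem towerBounded_snd {f : α → ℕ} (hf : TowerBounded size f) :
    TowerBounded size (fun v : ℕ × α => f v.2) :=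
  hf.comp Prod.snd (TowerBounded.self.mono fun v => by rw [size_cons]; omega)

/-- A function that ignores the first argument. -/
theorem weaken (hf : Elem f) : Elem (fun v : ℕ × α => f v.2) := by
  obtain ⟨c, T, hT, hf, hc⟩ := hf
  refine ⟨c.comp Code.tail, _, (TowerBounded.const 1).add (towerBounded_snd hT),
    towerBounded_snd hf, fun v acc => ?_⟩
  obtain ⟨r, hr⟩ := hc v.2 acc
  exact ⟨r, Runs.tail.comp hr⟩

/-- An elementary quantity depending on an index is bounded uniformly for all indices below an
elementary bound. -/
theorem exists_uniform {e : α → ℕ} {f : ℕ × α → ℕ} (hf : TowerBounded size f)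
    (he : TowerBounded size e) :
    ∃ M : α → ℕ, TowerBounded size M ∧ ∀ v i, i ≤ e v → f (i, v) ≤ M v := by
  obtain ⟨h, hh⟩ := hf
  have h1 : TowerBounded (fun n : ℕ => n) (tower h) := ⟨h, fun _ => le_rfl⟩
  refine ⟨fun v => tower h (e v + size v), h1.comp (fun v => e v + size v) (he.add .self),
    fun v i hi => (hh _).trans (tower_mono _ ?_)⟩
  rw [size_cons]
  exact Nat.add_le_add_right hi _

/-- Bounded recursion: `mid v n` is the value of the accumulator when `n` rounds remain. -/
theorem loop {e : α → ℕ} {mid : α → ℕ → ℕ} {g : ℕ → ℕ → α → ℕ}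
    (he : Elem e)
    (hx : Elem (fun v => mid v (e v)))
    (hg : Elem (fun p : ℕ × ℕ × α => g p.1 p.2.1 p.2.2))
    (hstep : ∀ v n, n < e v → g n (mid v (n + 1)) v = mid v n)
    {M : α → ℕ} (hM : TowerBounded size M) (hmid : ∀ v n, n ≤ e v → mid v n ≤ M v) :
    Elem (fun v => mid v 0) := by
  obtain ⟨ce, Te, hTe, hbe, hce⟩ := he
  obtain ⟨cx, Tx, hTx, hbx, hcx⟩ := hx
  obtain ⟨cg, Tg, hTg, hbg, hcg⟩ := hg
  obtain ⟨hT, hTg⟩ := hTg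
  have h1 : TowerBounded (fun n : ℕ => n) (tower hT) := ⟨hT, fun _ => le_rfl⟩
  have hU : TowerBounded size (fun v => tower hT (e v + (M v + size v))) :=
    h1.comp (fun v => e v + (M v + size v)) (hbe.add (hM.add .self))
  let body : Code := (Code.tail.comp Code.zero').cons (cg.cons (tails 2))
  refine ⟨(loopCode body).comp (ce.cons (cx.cons (tails 0))), _,
    ((hTe.add (hTx.add (.const 2))).add ((hbe.add (.const 1)).mul
      ((hU.add (.const 6)).add (.const 4)))), hM.mono fun v => hmid v 0 (Nat.zero_le _),
    fun v acc => ?_⟩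
  obtain ⟨re, hre⟩ := hce v acc
  obtain ⟨rx, hrx⟩ := hcx v acc
  refine ⟨Env.toList v ++ acc, ?_⟩
  refine (hre.cons (hrx.cons (Runs.tails 0 _))).comp
    (Runs.loop (N := e v) (st := fun n => mid v n :: (Env.toList v ++ acc)) fun n hn => ?_)
  obtain ⟨rg, hrg⟩ := hcg (n, mid v (n + 1), v) acc
  rw [← hstep v n hn]
  refine (Runs.id.cons (hrg.cons (Runs.tails 2 _))).mono ?_
  have := (hTg (n, mid v (n + 1), v)).trans (tower_mono hT (y := e v + (M v + size v)) (by
    have := hmid v (n + 1) hn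
    simp only [size_cons]
    omega))
  omega

theorem add (hf : Elem f) (hg : Elem g) : Elem (fun v => f v + g v) := by
  have h := loop (mid := fun v n => f v + (g v - n)) (g := fun _ x _ => x + 1) hg
    (by simpa using hf) Elem.fst.weaken.succ (fun v n hn => by omega)
    (hf.towerBounded.add hg.towerBounded) (fun v n hn => by omega)
  simpa using h

theorem pred (hf : Elem f) : Elem (fun v => f v - 1) := by
  obtain ⟨c, T, hT, hf, hc⟩ := hf
  refine ⟨(Code.zero'.case (Code.tail.comp Code.zero')).comp c, _, hT.add (.const 2),
    hf.mono fun v => Nat.sub_le _ _, fun v acc => ?_⟩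
  obtain ⟨r, hr⟩ := hc v acc
  cases hv : f v with
  | zero =>
    rw [hv] at hr
    refine ⟨r, hr.comp (Runs.case_zero (Runs.mono (t := 1) ?_ (by omega)))⟩
    simp only [hv]
    exact Runs.zero'
  | succ n =>
    rw [hv] at hr
    refine ⟨r, hr.comp (Runs.case_succ ?_)⟩
    simp only [hv, Nat.add_sub_cancel]
    exact Runs.id

theorem sub (hf : Elem f) (hg : Elem g) : Elem (fun v => f v - g v) := by
  have h := loop (mid := fun v n => f v - (g v - n)) (g := fun _ x _ => x - 1) hg
    (by simpa using hf) Elem.fst.weaken.pred (fun v n hn => by omega)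
    hf.towerBounded (fun v n hn => by omega)
  simpa using h

/-- A function that ignores the second argument. -/
theorem weaken_second {F : ℕ → α → ℕ} (hF : Elem (fun p : ℕ × α => F p.1 p.2)) :
    Elem (fun p : ℕ × ℕ × α => F p.1 p.2.2) := by
  obtain ⟨c, T, hT, hf, hc⟩ := hF
  have hj : TowerBounded size (fun p : ℕ × ℕ × α => size (p.1, p.2.2)) :=
    TowerBounded.self.mono fun v => by simp only [size_cons]; omega
  refine ⟨c.comp ((Code.tail.comp Code.zero').cons (tails 2)), _,
    ((TowerBounded.const 6).add (hT.comp (fun p : ℕ × ℕ × α => (p.1, p.2.2)) hj)),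
    hf.comp (fun p : ℕ × ℕ × α => (p.1, p.2.2)) hj, fun v acc => ?_⟩
  obtain ⟨r, hr⟩ := hc (v.1, v.2.2) acc
  exact ⟨r, (Runs.id.cons (Runs.tails 2 _)).comp hr⟩

theorem sum {e : α → ℕ} {F : ℕ → α → ℕ} (he : Elem e)
    (hF : Elem (fun p : ℕ × α => F p.1 p.2)) :
    Elem (fun v => ∑ i ∈ Finset.range (e v), F i v) := by
  obtain ⟨M, hM, hFM⟩ := exists_uniform hF.towerBounded he.towerBounded
  have h := loop (mid := fun v n => ∑ i ∈ Finset.Ico n (e v), F i v)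
    (g := fun n x v => x + F n v) he
    (by simpa using Elem.const 0) (Elem.fst.weaken.add hF.weaken_second)
    (fun v n hn => by rw [Finset.sum_eq_sum_Ico_succ_bot hn, add_comm])
    (he.towerBounded.mul hM) (fun v n hn => by
      refine (Finset.sum_le_card_nsmul _ _ (M v) fun i hi => hFM v i ?_).trans ?_
      · exact (Finset.mem_Ico.1 hi).2.le
      · simp only [Nat.card_Ico, smul_eq_mul]
        exact Nat.mul_le_mul_right _ (Nat.sub_le _ _))
  simpa only [Nat.Ico_zero_eq_range] using h

theorem mul (hf : Elem f) (hg : Elem g) : Elem (fun v => f v * g v) := by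
  have h := sum (F := fun _ v => g v) hf hg.weaken
  simpa using h

theorem prod {e : α → ℕ} {F : ℕ → α → ℕ} (he : Elem e)
    (hF : Elem (fun p : ℕ × α => F p.1 p.2)) :
    Elem (fun v => ∏ i ∈ Finset.range (e v), F i v) := by
  obtain ⟨M, hM, hFM⟩ := exists_uniform hF.towerBounded he.towerBounded
  have h := loop (mid := fun v n => ∏ i ∈ Finset.Ico n (e v), F i v)
    (g := fun n x v => x * F n v) he
    (by simpa using Elem.const 1) (Elem.fst.weaken.mul hF.weaken_second)
    (fun v n hn => by rw [Finset.prod_eq_prod_Ico_succ_bot hn, mul_comm])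
    ((hM.add (.const 1)).pow he.towerBounded) (fun v n hn => by
      refine (Finset.prod_le_pow_card _ _ (M v + 1) fun i hi => (hFM v i ?_).trans ?_).trans ?_
      · exact (Finset.mem_Ico.1 hi).2.le
      · omega
      · exact Nat.pow_le_pow_right (by omega) (by simp))
  simpa only [Nat.Ico_zero_eq_range] using h

theorem pow (hf : Elem f) (hg : Elem g) : Elem (fun v => f v ^ g v) := by
  have h := prod (F := fun _ v => f v) hg hf.weaken
  simpa using h

end Elem

/-! ### Elementary predicates -/

theorem bitOf_of_true {p : Prop} (h : p) : bitOf p = 1 := by simp [bitOf, h]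

theorem bitOf_of_false {p : Prop} (h : ¬ p) : bitOf p = 0 := by simp [bitOf, h]

/-- Predicates that are decided in elementary time. -/
def ElemPred (P : α → Prop) : Prop := Elem (fun v => bitOf (P v))

namespace ElemPred

variable {P Q : α → Prop} {f g : α → ℕ}

theorem not (hP : ElemPred P) : ElemPred (fun v => ¬ P v) := by
  have h := (Elem.const 1).sub hP
  refine cast (congrArg Elem (funext fun v => ?_)) h
  by_cases hp : P v <;> simp [bitOf, hp]

theorem and (hP : ElemPred P) (hQ : ElemPred Q) : ElemPred (fun v => P v ∧ Q v) := by
  have h := Elem.mul hP hQ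
  refine cast (congrArg Elem (funext fun v => ?_)) h
  by_cases hp : P v <;> by_cases hq : Q v <;> simp [bitOf, hp, hq]

theorem congr (hP : ElemPred P) (h : ∀ v, P v ↔ Q v) : ElemPred Q := by
  rwa [show P = Q from funext fun v => propext (h v)] at hP

theorem or (hP : ElemPred P) (hQ : ElemPred Q) : ElemPred (fun v => P v ∨ Q v) :=
  (hP.not.and hQ.not).not.congr fun v => by tauto

theorem imp (hP : ElemPred P) (hQ : ElemPred Q) : ElemPred (fun v => P v → Q v) :=
  (hP.and hQ.not).not.congr fun v => by tauto

theorem le (hf : Elem f) (hg : Elem g) : ElemPred (fun v => f v ≤ g v) := by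
  have h := (Elem.const 1).sub (hf.sub hg)
  refine cast (congrArg Elem (funext fun v => ?_)) h
  by_cases hp : f v ≤ g v
  · rw [bitOf_of_true hp]; omega
  · rw [bitOf_of_false hp]; omega

theorem lt (hf : Elem f) (hg : Elem g) : ElemPred (fun v => f v < g v) :=
  le hf.succ hg

theorem eq (hf : Elem f) (hg : Elem g) : ElemPred (fun v => f v = g v) :=
  ((le hf hg).and (le hg hf)).congr fun v => by omega

theorem ne (hf : Elem f) (hg : Elem g) : ElemPred (fun v => f v ≠ g v) := (eq hf hg).not

theorem ball {e : α → ℕ} {R : ℕ → α → Prop} (he : Elem e)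
    (hR : ElemPred (fun p : ℕ × α => R p.1 p.2)) :
    ElemPred (fun v => ∀ i < e v, R i v) := by
  have h := Elem.prod (F := fun i v => bitOf (R i v)) he hR
  refine cast (congrArg Elem (funext fun v => ?_)) h
  by_cases hp : ∀ i < e v, R i v
  · rw [bitOf_of_true hp]
    exact Finset.prod_eq_one fun i hi => bitOf_of_true (hp i (Finset.mem_range.1 hi))
  · rw [bitOf_of_false hp]
    push Not at hp
    obtain ⟨i, hi, hn⟩ := hp
    exact Finset.prod_eq_zero (Finset.mem_range.2 hi) (bitOf_of_false hn)

theorem bex {e : α → ℕ} {R : ℕ → α → Prop} (he : Elem e)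
    (hR : ElemPred (fun p : ℕ × α => R p.1 p.2)) :
    ElemPred (fun v => ∃ i < e v, R i v) :=
  (ball (R := fun i v => ¬ R i v) he hR.not).not.congr fun v => by push Not; rfl

end ElemPred

namespace Elem

variable {f g : α → ℕ}

/-- A least number is the sum of the bits telling which numbers are below it; division and
bounded search are reduced to sums in this way. -/
theorem sum_bitOf_lt (n m : ℕ) : ∑ i ∈ Finset.range n, bitOf (i < m) = min n m := by
  induction n with
  | zero => simp
  | succ n ih =>
    rw [Finset.sum_range_succ, ih]
    by_cases h : n < m
    · rw [bitOf_of_true h]; omega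
    · rw [bitOf_of_false h]; omega

theorem div (hf : Elem f) (hg : Elem g) (hpos : ∀ v, 0 < g v) : Elem (fun v => f v / g v) := by
  have h := sum (F := fun i v => bitOf ((i + 1) * g v ≤ f v)) hf
    (ElemPred.le (fst.succ.mul hg.weaken) hf.weaken)
  refine cast (congrArg Elem (funext fun v => ?_)) h
  have : ∀ i, (i + 1) * g v ≤ f v ↔ i < f v / g v := fun i => by
    rw [Nat.lt_iff_add_one_le, Nat.le_div_iff_mul_le (hpos v)]
  simp only [this, sum_bitOf_lt]
  exact min_eq_right (Nat.div_le_self _ _)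

theorem mod (hf : Elem f) (hg : Elem g) (hpos : ∀ v, 0 < g v) : Elem (fun v => f v % g v) := by
  have h := hf.sub (hg.mul (div hf hg hpos))
  refine cast (congrArg Elem (funext fun v => ?_)) h
  have := Nat.mod_add_div (f v) (g v)
  omega

theorem ite {P : α → Prop} [∀ v, Decidable (P v)] (hP : ElemPred P) (hf : Elem f)
    (hg : Elem g) : Elem (fun v => if P v then f v else g v) := by
  have h := (Elem.mul hP hf).add (Elem.mul hP.not hg)
  refine cast (congrArg Elem (funext fun v => ?_)) h
  by_cases hp : P v <;> simp [bitOf, hp]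

end Elem

/-! ### Programs that print lists -/

/-- Lists of numbers that are printed in elementary time; the program inserts the list behind the
block of arguments and in front of what was printed before, so that long lists are printed from the
end. -/
def Emits (f : α → List ℕ) : Prop :=
  ∃ (c : Code) (T : α → ℕ), TowerBounded size T ∧
    ∀ v acc, Runs c (Env.toList v ++ acc) (Env.toList v ++ (f v ++ acc)) (T v)

/-- `insertCode c j n` computes the entries `j, …, j + n - 1` of its input, followed by the head
of the result of `c`, followed by the remaining entries. -/
def insertCode (c : Code) : ℕ → ℕ → Code
  | j, 0 => c.cons (tails j)
  | j, n + 1 => (tails j).cons (insertCode c (j + 1) n)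

theorem Runs.insertCode {c : Code} {L r : List ℕ} {x t : ℕ} (hc : Runs c L (x :: r) t)
    (j n : ℕ) (h : j + n ≤ L.length) :
    Runs (insertCode c j n) L ((L.drop j).take n ++ x :: L.drop (j + n))
      (t + (n + 1) * (j + n + 2)) := by
  induction n generalizing j with
  | zero =>
    exact (hc.cons (Runs.tails j L)).mono (by omega)
  | succ n ih =>
    have hj : j < L.length := by omega
    have := (Runs.tails j L).cons (ih (j + 1) (by omega))
    rw [List.drop_eq_getElem_cons hj] at this ⊢
    rw [show j + 1 + n = j + (n + 1) by omega] at this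
    refine this.mono ?_
    have : (n + 1 + 1) * (j + (n + 1) + 2) = (n + 1) * (j + (n + 1) + 2) + (j + (n + 1) + 2) := by
      ring
    omega

namespace Emits

variable {f g : α → List ℕ}

theorem nil : Emits (fun _ : α => []) :=
  ⟨Code.tail.comp Code.zero', fun _ => 2, .const 2, fun _ _ => Runs.id⟩

theorem singleton {f : α → ℕ} (hf : Elem f) : Emits (fun v => [f v]) := by
  obtain ⟨c, T, hT, -, hc⟩ := hf
  refine ⟨insertCode c 0 (Env.len α), _,
    hT.add (.const ((Env.len α + 1) * (0 + Env.len α + 2))), fun v acc => ?_⟩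
  obtain ⟨r, hr⟩ := hc v acc
  have h := Runs.insertCode hr 0 (Env.len α) (by simp [Env.length_toList])
  have h1 : (Env.toList v ++ acc).take (Env.len α) = Env.toList v :=
    List.take_left' (Env.length_toList v)
  have h2 : (Env.toList v ++ acc).drop (Env.len α) = acc :=
    List.drop_left' (Env.length_toList v)
  simpa [h1, h2] using h

theorem append (hf : Emits f) (hg : Emits g) : Emits (fun v => f v ++ g v) := by
  obtain ⟨c, T, hT, hc⟩ := hf
  obtain ⟨c', T', hT', hc'⟩ := hg
  refine ⟨c.comp c', _, hT'.add hT, fun v acc => ?_⟩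
  rw [List.append_assoc]
  exact (hc' v acc).comp (hc v _)

theorem cons {f : α → ℕ} (hf : Elem f) (hg : Emits g) : Emits (fun v => f v :: g v) :=
  (singleton hf).append hg

theorem flatMap {e : α → ℕ} {F : ℕ → α → List ℕ} (he : Elem e)
    (hF : Emits (fun p : ℕ × α => F p.1 p.2)) :
    Emits (fun v => (List.range (e v)).flatMap fun i => F i v) := by
  obtain ⟨ce, Te, hTe, hbe, hce⟩ := he
  obtain ⟨c, T, hT, hc⟩ := hF
  obtain ⟨M, hM, hTM⟩ := Elem.exists_uniform hT hbe
  refine ⟨(loopCode c).comp (ce.cons (tails 0)), _,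
    (hTe.add (.const 2)).add ((hbe.add (.const 1)).mul (hM.add (.const 4))),
    fun v acc => ?_⟩
  obtain ⟨re, hre⟩ := hce v acc
  have h := Runs.loop (c := c) (N := e v) (M := M v) (st := fun n => Env.toList v ++
    ((((List.range (e v)).drop n).flatMap fun i => F i v) ++ acc)) fun n hn => ?_
  · simp only [List.drop_zero] at h
    refine (hre.cons (Runs.tails 0 _)).comp ?_
    rw [List.drop_eq_nil_of_le (by simp)] at h
    exact h
  · have h := hc (n, v) ((((List.range (e v)).drop (n + 1)).flatMap fun i => F i v) ++ acc)
    rw [List.drop_eq_getElem_cons (l := List.range (e v)) (i := n) (by simpa using hn)]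
    simp only [List.getElem_range, List.flatMap_cons, List.append_assoc]
    exact h.mono (hTM v n hn.le)

theorem map {e : α → ℕ} {F : ℕ → α → ℕ} (he : Elem e)
    (hF : Elem (fun p : ℕ × α => F p.1 p.2)) :
    Emits (fun v => (List.range (e v)).map fun i => F i v) := by
  have h := flatMap (F := fun i v => [F i v]) he (singleton hF)
  refine cast (congrArg Emits (funext fun v => ?_)) h
  exact List.flatMap_pure_eq_map _ _

theorem weaken (hf : Emits f) : Emits (fun v : ℕ × α => f v.2) := by
  obtain ⟨c, T, hT, hc⟩ := hf
  refine ⟨(Code.tail.comp Code.zero').cons (c.comp Code.tail), _,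
    (TowerBounded.const 2).add ((TowerBounded.const 1).add (Elem.towerBounded_snd hT)),
    fun v acc => ?_⟩
  exact Runs.id.cons (Runs.tail.comp (hc v.2 acc))

theorem ite {P : α → Prop} [∀ v, Decidable (P v)] (hP : ElemPred P) (hf : Emits f)
    (hg : Emits g) : Emits (fun v => if P v then f v else g v) := by
  have h := (flatMap (F := fun _ v => f v) hP hf.weaken).append
    (flatMap (F := fun _ v => g v) hP.not hg.weaken)
  refine cast (congrArg Emits (funext fun v => ?_)) h
  by_cases hp : P v <;> simp [bitOf, hp]

end Emits

end SphereCRA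

namespace SphereCRA

/-! ### Numbers as codes of coloured spheres, states and source maps -/

/-- The parameters of the construction: the radius, and the numbers of relation symbols, letters
and data values per position. -/
structure Par where
  B : ℕ
  s : ℕ
  a : ℕ
  m : ℕ

instance : Env Par where
  toList P := [P.B, P.s, P.a, P.m]
  len := 4
  length_toList _ := rfl

/-- Digit number `i` of `n` in base `b`. -/
def dig (b n i : ℕ) : ℕ := n / b ^ i % b

/-- The least `i < n` that satisfies `p`, or `n` if there is none. -/
noncomputable def first (n : ℕ) (p : ℕ → Prop) : ℕ :=
  ∑ i ∈ Finset.range n, bitOf (∀ j < i + 1, ¬ p j)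

namespace Par

variable (P : Par)

/-- The number of colours. It exceeds the number of positions at distance at most `4 * B + 1`
from a given one. -/
def colours : ℕ := (2 * P.s + 1) ^ (4 * P.B + 1)

/-- The base in which coloured spheres are written. -/
def base : ℕ := P.B + P.a + P.m + P.colours + 2

/-- The number of digits that describe one colour of a coloured sphere. -/
def fields : ℕ := 2 + P.m + P.s

/-- The number of codes of coloured spheres. -/
def codes : ℕ := P.base ^ (P.colours * P.fields)

/-- The number of states. -/
def states : ℕ := P.colours * P.codes ^ P.colours

/-- The number of registers: one for every colour and every data index. -/
def regs : ℕ := P.colours * P.m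

/-- The number of source maps. -/
def sources : ℕ := (P.states + 1) ^ P.s

/-- The distance of the node of colour `α` from the center in the coloured sphere `S`; colours
that do not occur in `S` have a value above the radius. -/
def lev (S α : ℕ) : ℕ := dig P.base S (α * P.fields)

/-- The letter of the node of colour `α`. -/
def lab (S α : ℕ) : ℕ := dig P.base S (α * P.fields + 1)

/-- A name for the class of the data index `k` at the node of colour `α`. -/
def cls (S α k : ℕ) : ℕ := dig P.base S (α * P.fields + 2 + k)

/-- One plus the colour of the `x`-successor of the node of colour `α`, or zero if there is
none. -/
def out (S α x : ℕ) : ℕ := dig P.base S (α * P.fields + 2 + P.m + x)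

/-- The colour of a position in state `q`. -/
def own (q : ℕ) : ℕ := q % P.colours

/-- The code of the sphere whose center has colour `γ`, as seen from a position in state `q`. -/
def sph (q γ : ℕ) : ℕ := dig P.codes (q / P.colours) γ

/-- One plus the state of the `x`-predecessor, or zero if there is none. -/
def src (z x : ℕ) : ℕ := dig (P.states + 1) z x

/-- The colour `α` occurs in the coloured sphere `S`. -/
def InV (S α : ℕ) : Prop := P.lev S α ≤ P.B

/-- In the coloured sphere `S` there is an `x`-edge from the node of colour `α` to the node of
colour `β`. Only its restriction to the colours that occur in `S` is meaningful. -/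
def Edge (S x α β : ℕ) : Prop := P.out S α x = β + 1

/-- The code `S` describes a sphere whose center has colour `c`. The conditions on the levels say
that they are the distances from the center; out-degrees are at most one by the choice of the
encoding, and the last condition bounds the in-degrees. -/
def SphereOK (S c : ℕ) : Prop :=
  P.lev S c = 0 ∧
  (∀ α < P.colours, P.InV S α → P.lev S α = 0 → α = c) ∧
  (∀ α < P.colours, P.InV S α → P.lev S α ≠ 0 →
    ∃ β < P.colours, P.lev S β + 1 = P.lev S α ∧ ∃ x < P.s, P.Edge S x α β ∨ P.Edge S x β α) ∧
  ∀ x < P.s, ∀ α < P.colours, P.InV S α → ∀ β < P.colours, P.InV S β → P.Edge S x α β →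
    P.lev S β ≤ P.lev S α + 1 ∧ P.lev S α ≤ P.lev S β + 1 ∧
    ∀ α' < P.colours, P.InV S α' → P.Edge S x α' β → α' = α

/-- The sphere of colour `γ` contains the position whose state is `q`. -/
def Active (q γ : ℕ) : Prop := P.InV (P.sph q γ) (P.own q)

/-- All spheres seen from a position agree about its letter and its partition. -/
def AgreeOK (q : ℕ) : Prop :=
  ∀ γ < P.colours, P.Active q γ →
    P.lab (P.sph q γ) (P.own q) = P.lab (P.sph q (P.own q)) (P.own q) ∧
    ∀ k < P.m, P.cls (P.sph q γ) (P.own q) k = P.cls (P.sph q (P.own q)) (P.own q) k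

/-- No sphere requires an `x`-successor of a position in state `q`. -/
def NoOut (q x : ℕ) : Prop :=
  ∀ γ < P.colours, P.Active q γ → ∀ β < P.colours, P.InV (P.sph q γ) β →
    ¬ P.Edge (P.sph q γ) x (P.own q) β

/-- No sphere requires an `x`-predecessor of a position in state `q`. -/
def NoIn (q x : ℕ) : Prop :=
  ∀ γ < P.colours, P.Active q γ → ∀ β < P.colours, P.InV (P.sph q γ) β →
    ¬ P.Edge (P.sph q γ) x β (P.own q)

/-- The sphere `S` contains the node of colour `α`, and it has to contain a neighbour of colour
`β` of this node as well, because it contains this colour or because the node is not on its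
boundary. -/
def Needs (S α β : ℕ) : Prop := P.InV S α ∧ (P.InV S β ∨ P.lev S α < P.B)

/-- Compatibility of the states `p` and `q` of two positions that are joined by an `x`-edge: the
`x`-edges that their spheres require at the two positions are this edge, and a sphere that contains
one of the positions and has to contain the other one is seen from both of them and contains the
edge. -/
def Link (p q x : ℕ) : Prop :=
  ∀ γ < P.colours,
    (P.Active p γ → ∀ β < P.colours, P.InV (P.sph p γ) β →
      P.Edge (P.sph p γ) x (P.own p) β → β = P.own q) ∧
    (P.Active q γ → ∀ β < P.colours, P.InV (P.sph q γ) β →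
      P.Edge (P.sph q γ) x β (P.own q) → β = P.own p) ∧
    (P.Needs (P.sph p γ) (P.own p) (P.own q) ∨ P.Needs (P.sph q γ) (P.own q) (P.own p) →
      P.sph p γ = P.sph q γ ∧ P.Active p γ ∧ P.Active q γ ∧
      P.Edge (P.sph q γ) x (P.own p) (P.own q))

/-- The state `q` is possible at a position whose predecessors have the states given by `z`. -/
def TransOK (z q : ℕ) : Prop :=
  P.SphereOK (P.sph q (P.own q)) (P.own q) ∧ P.AgreeOK q ∧
  ∀ x < P.s, (P.src z x = 0 → P.NoIn q x) ∧ (P.src z x ≠ 0 → P.Link (P.src z x - 1) q x)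

/-- Positions in states `p` and `q` belong to a common sphere in which the colour `α` occurs. -/
def Shares (p q α : ℕ) : Prop :=
  ∃ γ < P.colours, P.sph p γ = P.sph q γ ∧ P.Active p γ ∧ P.Active q γ ∧ P.InV (P.sph q γ) α

/-- The registers of colour `α` at the `x`-predecessor are meaningful at the current position. -/
def Tracked (z q x α : ℕ) : Prop := P.src z x ≠ 0 ∧ P.Shares (P.src z x - 1) q α

/-- The relation symbol along which registers of colour `α` are copied, or the number of relation
symbols if they are to be guessed. -/
noncomputable def carrier (z q α : ℕ) : ℕ := first P.s (fun x => P.Tracked z q x α)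

/-- The colours of the nodes of the graph attached to the state `q`. If `q` does not describe a
sphere, this graph has a single node. -/
def IsNode (q α : ℕ) : Prop :=
  (P.SphereOK (P.sph q (P.own q)) (P.own q) ∧ P.InV (P.sph q (P.own q)) α) ∨
  (¬ P.SphereOK (P.sph q (P.own q)) (P.own q) ∧ α = P.own q)

theorem colours_pos : 0 < P.colours := Nat.pow_pos (by omega)
theorem base_pos : 0 < P.base := by unfold base; omega
theorem codes_pos : 0 < P.codes := Nat.pow_pos P.base_pos
theorem own_lt (q : ℕ) : P.own q < P.colours := Nat.mod_lt _ P.colours_pos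
theorem src_lt (z x : ℕ) : P.src z x < P.states + 1 := Nat.mod_lt _ (Nat.succ_pos _)

end Par

/-! ### The conditions on states are decided in elementary time -/

variable {α : Type} [Env α]

/-- Parameters that are available in elementary time. -/
structure ElemPar (p : α → Par) : Prop where
  B : Elem (fun v => (p v).B)
  s : Elem (fun v => (p v).s)
  a : Elem (fun v => (p v).a)
  m : Elem (fun v => (p v).m)

theorem elemPar_id : ElemPar (fun P : Par => P) := by
  have key : ∀ (n : ℕ) (f : Par → ℕ), (∀ P, ∃ r, (Env.toList P).drop n = f P :: r) →
      Elem f := fun n f h => by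
    refine ⟨tails n, fun _ => n + 2, .const _, TowerBounded.self.mono fun P => ?_,
      fun P acc => ?_⟩
    · obtain ⟨r, hr⟩ := h P
      have hmem : f P ∈ Env.toList P := List.mem_of_mem_drop (i := n) (by simp [hr])
      exact List.le_sum_of_mem hmem
    · obtain ⟨r, hr⟩ := h P
      refine ⟨r ++ acc, ?_⟩
      have hn : n ≤ (Env.toList P).length := by
        by_contra hlt
        rw [List.drop_eq_nil_of_le (by omega)] at hr
        cases hr
      have := Runs.tails n (Env.toList P ++ acc)
      rwa [List.drop_append_of_le_length hn, hr] at this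
  exact ⟨key 0 _ fun P => ⟨_, rfl⟩, key 1 _ fun P => ⟨_, rfl⟩, key 2 _ fun P => ⟨_, rfl⟩,
    key 3 _ fun P => ⟨_, rfl⟩⟩

theorem Elem.first {e : α → ℕ} {R : ℕ → α → Prop} (he : Elem e)
    (hR : ElemPred (fun p : ℕ × α => R p.1 p.2)) :
    Elem (fun v => first (e v) (fun i => R i v)) :=
  he.sum (F := fun i v => bitOf (∀ j < i + 1, ¬ R j v))
    (ElemPred.ball (R := fun j (p : ℕ × α) => ¬ R j p.2) Elem.fst.succ
      (ElemPred.not (Elem.weaken_second (F := fun i v => bitOf (R i v)) hR)))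

theorem Elem.dig {b n i : α → ℕ} (hb : Elem b) (hn : Elem n) (hi : Elem i)
    (hpos : ∀ v, 0 < b v) : Elem (fun v => dig (b v) (n v) (i v)) :=
  (hn.div (hb.pow hi) fun v => Nat.pow_pos (hpos v)).mod hb hpos

namespace ElemPar

variable {p : α → Par}

theorem weaken (hp : ElemPar p) : ElemPar (fun v : ℕ × α => p v.2) :=
  ⟨hp.B.weaken, hp.s.weaken, hp.a.weaken, hp.m.weaken⟩

theorem colours (hp : ElemPar p) : Elem (fun v => (p v).colours) :=
  (((Elem.const 2).mul hp.s).succ).pow (((Elem.const 4).mul hp.B).succ)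

theorem base (hp : ElemPar p) : Elem (fun v => (p v).base) :=
  (((hp.B.add hp.a).add hp.m).add hp.colours).succ.succ

theorem fields (hp : ElemPar p) : Elem (fun v => (p v).fields) :=
  ((Elem.const 2).add hp.m).add hp.s

theorem codes (hp : ElemPar p) : Elem (fun v => (p v).codes) :=
  hp.base.pow (hp.colours.mul hp.fields)

theorem states (hp : ElemPar p) : Elem (fun v => (p v).states) :=
  hp.colours.mul (hp.codes.pow hp.colours)

theorem regs (hp : ElemPar p) : Elem (fun v => (p v).regs) := hp.colours.mul hp.m

theorem sources (hp : ElemPar p) : Elem (fun v => (p v).sources) := hp.states.succ.pow hp.s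

variable {S A A' X K q q' z : α → ℕ}

theorem lev (hp : ElemPar p) (hS : Elem S) (hA : Elem A) :
    Elem (fun v => (p v).lev (S v) (A v)) :=
  hp.base.dig hS (hA.mul hp.fields) fun v => (p v).base_pos

theorem lab (hp : ElemPar p) (hS : Elem S) (hA : Elem A) :
    Elem (fun v => (p v).lab (S v) (A v)) :=
  hp.base.dig hS (hA.mul hp.fields).succ fun v => (p v).base_pos

theorem cls (hp : ElemPar p) (hS : Elem S) (hA : Elem A) (hK : Elem K) :
    Elem (fun v => (p v).cls (S v) (A v) (K v)) :=
  hp.base.dig hS ((hA.mul hp.fields).succ.succ.add hK) fun v => (p v).base_pos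

theorem out (hp : ElemPar p) (hS : Elem S) (hA : Elem A) (hX : Elem X) :
    Elem (fun v => (p v).out (S v) (A v) (X v)) :=
  hp.base.dig hS (((hA.mul hp.fields).succ.succ.add hp.m).add hX) fun v => (p v).base_pos

theorem own (hp : ElemPar p) (hq : Elem q) : Elem (fun v => (p v).own (q v)) :=
  hq.mod hp.colours fun v => (p v).colours_pos

theorem sph (hp : ElemPar p) (hq : Elem q) (hA : Elem A) :
    Elem (fun v => (p v).sph (q v) (A v)) :=
  hp.codes.dig (hq.div hp.colours fun v => (p v).colours_pos) hA fun v => (p v).codes_pos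

theorem src (hp : ElemPar p) (hz : Elem z) (hX : Elem X) :
    Elem (fun v => (p v).src (z v) (X v)) :=
  hp.states.succ.dig hz hX fun _ => Nat.succ_pos _

theorem inV (hp : ElemPar p) (hS : Elem S) (hA : Elem A) :
    ElemPred (fun v => (p v).InV (S v) (A v)) :=
  ElemPred.le (hp.lev hS hA) hp.B

theorem edge (hp : ElemPar p) (hS : Elem S) (hX : Elem X) (hA : Elem A) (hA' : Elem A') :
    ElemPred (fun v => (p v).Edge (S v) (X v) (A v) (A' v)) :=
  ElemPred.eq (hp.out hS hA hX) hA'.succ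

theorem sphereOK (hp : ElemPar p) (hS : Elem S) (hA : Elem A) :
    ElemPred (fun v => (p v).SphereOK (S v) (A v)) := by
  have hp1 := hp.weaken
  have hp2 := hp1.weaken
  have hp3 := hp2.weaken
  have hp4 := hp3.weaken
  have hS1 := hS.weaken
  have hS2 := hS1.weaken
  have hS3 := hS2.weaken
  have hS4 := hS3.weaken
  refine (ElemPred.eq (hp.lev hS hA) (.const 0)).and ((ElemPred.ball hp.colours ?_).and
    ((ElemPred.ball hp.colours ?_).and (ElemPred.ball hp.s (ElemPred.ball hp1.colours ?_))))
  · exact (hp1.inV hS1 .fst).imp ((ElemPred.eq (hp1.lev hS1 .fst) (.const 0)).imp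
      (ElemPred.eq .fst hA.weaken))
  · refine (hp1.inV hS1 .fst).imp ((ElemPred.ne (hp1.lev hS1 .fst) (.const 0)).imp
      (ElemPred.bex hp1.colours ((ElemPred.eq (hp2.lev hS2 .fst).succ
        (hp2.lev hS2 (Elem.weaken .fst))).and (ElemPred.bex hp2.s ?_))))
    exact (hp3.edge hS3 .fst (Elem.weaken (Elem.weaken .fst)) (Elem.weaken .fst)).or
      (hp3.edge hS3 .fst (Elem.weaken .fst) (Elem.weaken (Elem.weaken .fst)))
  · refine (hp2.inV hS2 .fst).imp (ElemPred.ball hp2.colours ((hp3.inV hS3 .fst).imp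
      ((hp3.edge hS3 (Elem.weaken (Elem.weaken .fst)) (Elem.weaken .fst) .fst).imp
      ((ElemPred.le (hp3.lev hS3 .fst) (hp3.lev hS3 (Elem.weaken .fst)).succ).and
      ((ElemPred.le (hp3.lev hS3 (Elem.weaken .fst)) (hp3.lev hS3 .fst).succ).and
      (ElemPred.ball hp3.colours ?_))))))
    exact (hp4.inV hS4 .fst).imp ((hp4.edge hS4 (Elem.weaken (Elem.weaken (Elem.weaken .fst)))
      .fst (Elem.weaken .fst)).imp (ElemPred.eq .fst (Elem.weaken (Elem.weaken .fst))))

theorem active (hp : ElemPar p) (hq : Elem q) (hA : Elem A) :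
    ElemPred (fun v => (p v).Active (q v) (A v)) :=
  hp.inV (hp.sph hq hA) (hp.own hq)

theorem agreeOK (hp : ElemPar p) (hq : Elem q) : ElemPred (fun v => (p v).AgreeOK (q v)) := by
  have hp1 := hp.weaken
  have hp2 := hp1.weaken
  have hq1 := hq.weaken
  have hq2 := hq1.weaken
  refine ElemPred.ball hp.colours ((hp1.active hq1 .fst).imp ((ElemPred.eq
    (hp1.lab (hp1.sph hq1 .fst) (hp1.own hq1))
    (hp1.lab (hp1.sph hq1 (hp1.own hq1)) (hp1.own hq1))).and (ElemPred.ball hp1.m ?_)))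
  exact ElemPred.eq (hp2.cls (hp2.sph hq2 (Elem.weaken .fst)) (hp2.own hq2) .fst)
    (hp2.cls (hp2.sph hq2 (hp2.own hq2)) (hp2.own hq2) .fst)

theorem noOut (hp : ElemPar p) (hq : Elem q) (hX : Elem X) :
    ElemPred (fun v => (p v).NoOut (q v) (X v)) := by
  have hp1 := hp.weaken
  have hp2 := hp1.weaken
  have hq1 := hq.weaken
  have hq2 := hq1.weaken
  have hS2 := hp2.sph hq2 (Elem.weaken Elem.fst)
  exact ElemPred.ball hp.colours ((hp1.active hq1 .fst).imp (ElemPred.ball hp1.colours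
    ((hp2.inV hS2 .fst).imp (hp2.edge hS2 hX.weaken.weaken (hp2.own hq2) .fst).not)))

theorem noIn (hp : ElemPar p) (hq : Elem q) (hX : Elem X) :
    ElemPred (fun v => (p v).NoIn (q v) (X v)) := by
  have hp1 := hp.weaken
  have hp2 := hp1.weaken
  have hq1 := hq.weaken
  have hq2 := hq1.weaken
  have hS2 := hp2.sph hq2 (Elem.weaken Elem.fst)
  exact ElemPred.ball hp.colours ((hp1.active hq1 .fst).imp (ElemPred.ball hp1.colours
    ((hp2.inV hS2 .fst).imp (hp2.edge hS2 hX.weaken.weaken .fst (hp2.own hq2)).not)))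

theorem needs (hp : ElemPar p) (hS : Elem S) (hA : Elem A) (hA' : Elem A') :
    ElemPred (fun v => (p v).Needs (S v) (A v) (A' v)) :=
  (hp.inV hS hA).and ((hp.inV hS hA').or (ElemPred.lt (hp.lev hS hA) hp.B))

theorem link (hp : ElemPar p) (hq' : Elem q') (hq : Elem q) (hX : Elem X) :
    ElemPred (fun v => (p v).Link (q' v) (q v) (X v)) := by
  have hp1 := hp.weaken
  have hp2 := hp1.weaken
  have hq1 := hq.weaken
  have hq2 := hq1.weaken
  have hr1 := hq'.weaken
  have hr2 := hr1.weaken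
  have hS1 := hp1.sph hq1 Elem.fst
  have hS2 := hp2.sph hq2 (Elem.weaken Elem.fst)
  have hR1 := hp1.sph hr1 Elem.fst
  have hR2 := hp2.sph hr2 (Elem.weaken Elem.fst)
  refine ElemPred.ball hp.colours (ElemPred.and ?_ (ElemPred.and ?_ ?_))
  · exact (hp1.active hr1 .fst).imp (ElemPred.ball hp1.colours
      ((hp2.inV hR2 .fst).imp ((hp2.edge hR2 hX.weaken.weaken (hp2.own hr2) .fst).imp
        (ElemPred.eq .fst (hp2.own hq2)))))
  · exact (hp1.active hq1 .fst).imp (ElemPred.ball hp1.colours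
      ((hp2.inV hS2 .fst).imp ((hp2.edge hS2 hX.weaken.weaken .fst (hp2.own hq2)).imp
        (ElemPred.eq .fst (hp2.own hr2)))))
  · exact ((hp1.needs hR1 (hp1.own hr1) (hp1.own hq1)).or
      (hp1.needs hS1 (hp1.own hq1) (hp1.own hr1))).imp
      ((ElemPred.eq hR1 hS1).and ((hp1.active hr1 .fst).and ((hp1.active hq1 .fst).and
        (hp1.edge hS1 hX.weaken (hp1.own hr1) (hp1.own hq1)))))

theorem transOK (hp : ElemPar p) (hz : Elem z) (hq : Elem q) :
    ElemPred (fun v => (p v).TransOK (z v) (q v)) := by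
  have hp1 := hp.weaken
  have hx1 := hp1.src hz.weaken .fst
  exact (hp.sphereOK (hp.sph hq (hp.own hq)) (hp.own hq)).and ((hp.agreeOK hq).and
    (ElemPred.ball hp.s (((ElemPred.eq hx1 (.const 0)).imp (hp1.noIn hq.weaken .fst)).and
      ((ElemPred.ne hx1 (.const 0)).imp (hp1.link hx1.pred hq.weaken .fst)))))

theorem shares (hp : ElemPar p) (hq' : Elem q') (hq : Elem q) (hA : Elem A) :
    ElemPred (fun v => (p v).Shares (q' v) (q v) (A v)) := by
  have hp1 := hp.weaken
  have hq1 := hq.weaken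
  have hr1 := hq'.weaken
  have hS1 := hp1.sph hq1 Elem.fst
  have hR1 := hp1.sph hr1 Elem.fst
  exact ElemPred.bex hp.colours ((ElemPred.eq hR1 hS1).and ((hp1.active hr1 .fst).and
    ((hp1.active hq1 .fst).and (hp1.inV hS1 hA.weaken))))

theorem tracked (hp : ElemPar p) (hz : Elem z) (hq : Elem q) (hX : Elem X) (hA : Elem A) :
    ElemPred (fun v => (p v).Tracked (z v) (q v) (X v) (A v)) :=
  (ElemPred.ne (hp.src hz hX) (.const 0)).and (hp.shares (hp.src hz hX).pred hq hA)

theorem carrier (hp : ElemPar p) (hz : Elem z) (hq : Elem q) (hA : Elem A) :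
    Elem (fun v => (p v).carrier (z v) (q v) (A v)) :=
  Elem.first hp.s (hp.weaken.tracked hz.weaken hq.weaken .fst hA.weaken)

theorem isNode (hp : ElemPar p) (hq : Elem q) (hA : Elem A) :
    ElemPred (fun v => (p v).IsNode (q v) (A v)) := by
  have hS := hp.sph hq (hp.own hq)
  have hok := hp.sphereOK hS (hp.own hq)
  exact (hok.and (hp.inV hS hA)).or (hok.not.and (ElemPred.eq hA (hp.own hq)))

end ElemPar

end SphereCRA

namespace SphereCRA

/-! ### Distances -/

namespace Dist

variable {Λ σ V : Type*} {m : ℕ} {G : SGraph Λ σ m V} {i j k : V} {r t : ℕ} {x : σ}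

theorem refl (r : ℕ) (i : V) : G.DistLE r i i := by simp [SGraph.DistLE]

theorem zero_iff : G.DistLE 0 i j ↔ i = j := by simp [SGraph.DistLE]

theorem symm (h : G.DistLE r i j) : G.DistLE r j i := by
  unfold SGraph.DistLE at h ⊢
  rwa [SimpleGraph.edist_comm]

theorem mono (h : G.DistLE r i j) (hrt : r ≤ t) : G.DistLE t i j :=
  le_trans h (by exact_mod_cast hrt)

theorem trans (h : G.DistLE r i j) (h' : G.DistLE t j k) : G.DistLE (r + t) i k := by
  unfold SGraph.DistLE at h h' ⊢
  push_cast
  exact SimpleGraph.edist_triangle.trans (add_le_add h h')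

theorem of_edge (h : G.edge x i j) : G.DistLE 1 i j := by
  by_cases hij : i = j
  · exact hij ▸ refl 1 i
  · have hadj : G.undirected.Adj i j := (SimpleGraph.fromRel_adj _ _ _).2 ⟨hij, .inl ⟨x, h⟩⟩
    exact (SimpleGraph.edist_eq_one_iff_adj.2 hadj).le

theorem succ_cases (h : G.DistLE (r + 1) i j) : G.DistLE r i j ∨
    ∃ k x, G.DistLE r i k ∧ (G.edge x k j ∨ G.edge x j k) := by
  unfold SGraph.DistLE at h
  have hne : G.undirected.edist i j ≠ ⊤ := fun htop => by
    rw [htop] at h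
    exact absurd h (by simp)
  obtain ⟨w, hw⟩ := SimpleGraph.exists_walk_of_edist_ne_top hne
  rw [← hw] at h
  have hlen : w.length ≤ r + 1 := by exact_mod_cast h
  by_cases hr : w.length ≤ r
  · exact .inl (w.edist_le.trans (by exact_mod_cast hr))
  · right
    have hw0 : ¬ w.Nil := fun hn => by
      have := SimpleGraph.Walk.length_eq_zero_iff.2 hn
      omega
    refine ⟨w.penultimate, ?_⟩
    have hadj := w.adj_penultimate hw0
    obtain ⟨-, ⟨x, hx⟩ | ⟨x, hx⟩⟩ := (SimpleGraph.fromRel_adj _ _ _).1 hadj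
    · refine ⟨x, w.dropLast.edist_le.trans ?_, .inl hx⟩
      have := w.length_dropLast_add_one hw0
      exact_mod_cast (by omega : w.dropLast.length ≤ r)
    · refine ⟨x, w.dropLast.edist_le.trans ?_, .inr hx⟩
      have := w.length_dropLast_add_one hw0
      exact_mod_cast (by omega : w.dropLast.length ≤ r)

end Dist

/-! ### The automaton and the spheres attached to its states -/

open Classical in
theorem first_eq_min {n : ℕ} {p : ℕ → Prop} (hex : ∃ i, p i) :
    first n p = min n (Nat.find hex) := by
  have : ∀ i, (∀ j < i + 1, ¬ p j) ↔ i < Nat.find hex := fun i => by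
    rw [Nat.lt_find_iff]
    exact forall_congr' fun j => by rw [Nat.lt_succ_iff]
  simp only [first, this, Elem.sum_bitOf_lt]

theorem first_spec {n : ℕ} {p : ℕ → Prop} (h : first n p < n) : p (first n p) := by
  classical
  by_cases hex : ∃ i, p i
  · have hf := first_eq_min (n := n) hex
    rw [hf, min_eq_right (by omega)]
    exact Nat.find_spec hex
  · push Not at hex
    have : first n p = n := by
      simp [first, hex, bitOf]
    omega

theorem first_lt {n i : ℕ} {p : ℕ → Prop} (hi : i < n) (h : p i) : first n p < n := by
  classical
  have hf := first_eq_min (n := n) ⟨i, h⟩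
  have := Nat.find_min' ⟨i, h⟩ h
  omega

/-- The conjunction of a list of formulas. -/
def conj {β : Type*} : List (BoolFormula β) → BoolFormula β
  | [] => .tru
  | φ :: l => .and φ (conj l)

theorem eval_conj {β : Type*} {v : β → Prop} {l : List (BoolFormula β)} :
    (conj l).Eval v ↔ ∀ φ ∈ l, φ.Eval v := by
  induction l with
  | nil => simp [conj, BoolFormula.Eval]
  | cons φ l ih => simp [conj, BoolFormula.Eval, ih]

theorem mem_atoms_conj {β : Type*} {e : β} {l : List (BoolFormula β)}
    (h : e ∈ (conj l).atoms) : ∃ φ ∈ l, e ∈ φ.atoms := by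
  induction l with
  | nil => simp [conj, BoolFormula.atoms] at h
  | cons φ l ih =>
    rcases h with h | h
    · exact ⟨φ, by simp, h⟩
    · obtain ⟨ψ, hψ, h⟩ := ih h
      exact ⟨ψ, by simp [hψ], h⟩

theorem tokens_conj {β : Type*} (f : β → List ℕ) (l : List (BoolFormula β)) :
    (conj l).tokens f = l.flatMap (fun φ => 5 :: φ.tokens f) ++ [0] := by
  induction l with
  | nil => simp [conj, BoolFormula.tokens]
  | cons φ l ih => simp [conj, BoolFormula.tokens, ih]

namespace Par

variable (P : Par)

/-- The source map with code `z`. -/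
def srcMap (z : ℕ) (x : Fin P.s) : Option (Fin P.states) :=
  if h : P.src z x = 0 then none else some ⟨P.src z x - 1, by have := P.src_lt z x; omega⟩

/-- The colour to which a register belongs. -/
def regColour (r : ℕ) : ℕ := r / P.m

/-- The data index to which a register belongs. -/
def regIndex (r : Fin P.regs) : Fin P.m :=
  ⟨r % P.m, Nat.mod_lt _ (Nat.pos_of_ne_zero fun h => by
    have := r.2
    simp [regs, h] at this)⟩

/-- Atoms of the guards. -/
abbrev GuardAtom : Type :=
  GuardTerm (Fin P.s) (Fin P.regs) P.m × GuardTerm (Fin P.s) (Fin P.regs) P.m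

open Classical in
/-- The condition that data values with the indices `k` and `l` are equal or different, as required
by the state. -/
noncomputable def partFormula (q : ℕ) (k l : Fin P.m) : BoolFormula P.GuardAtom :=
  if P.cls (P.sph q (P.own q)) (P.own q) k = P.cls (P.sph q (P.own q)) (P.own q) l then
    .atom (.cur k, .cur l) else .neg (.atom (.cur k, .cur l))

open Classical in
/-- The condition on a register at the `x`-predecessor: a register that belongs to the current
position holds the current data value, and otherwise the register holds the same value as at the
predecessor from which it is copied. -/
noncomputable def regFormula (z q : ℕ) (x : Fin P.s) (r : Fin P.regs) :
    BoolFormula P.GuardAtom :=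
  if P.Tracked z q x (P.regColour r) then
    if P.regColour r = P.own q then .atom (.reg x r, .cur (P.regIndex r))
    else if h : P.carrier z q (P.regColour r) < P.s then .atom (.reg x r, .reg ⟨_, h⟩ r)
    else .tru
  else .tru

open Classical in
/-- The guard; it cannot be satisfied if the state is not possible. -/
noncomputable def guard (z q : ℕ) : BoolFormula P.GuardAtom :=
  if P.TransOK z q then
    conj ((List.finRange P.m).flatMap (fun k => (List.finRange P.m).map (P.partFormula q k)) ++
      (List.finRange P.s).flatMap (fun x => (List.finRange P.regs).map (P.regFormula z q x)))
  else .fls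

open Classical in
/-- The update of a register. Registers of the own colour are guessed within distance zero, which
sets them to the current data values. -/
noncomputable def update (z q : ℕ) (r : Fin P.regs) :
    Option (RegUpdate (Fin P.s) (Fin P.regs) P.m) :=
  if P.regColour r = P.own q then some (.guess (P.regIndex r) 0)
  else if h : P.carrier z q (P.regColour r) < P.s then some (.copy ⟨_, h⟩ r)
  else some (.guess (P.regIndex r) (2 * P.B))

/-- The transition into the state `q` with source map `z`. The letter is reduced modulo the size of
the alphabet, since the digits of `q` may exceed it. -/
noncomputable def trans (ha : 0 < P.a) (q : Fin P.states) (z : ℕ) :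
    CRATransition (Fin P.a) (Fin P.s) (Fin P.states) (Fin P.regs) P.m where
  src := P.srcMap z
  guard := P.guard z q
  letter := ⟨P.lab (P.sph q (P.own q)) (P.own q) % P.a, Nat.mod_lt _ ha⟩
  tgt := q
  upd := P.update z q

theorem srcMap_isSome {z : ℕ} {x : Fin P.s} (h : P.src z x ≠ 0) : (P.srcMap z x).isSome := by
  simp [srcMap, h]

theorem srcMap_eq_some {z : ℕ} {x : Fin P.s} {p : Fin P.states} :
    P.srcMap z x = some p ↔ P.src z x = p + 1 := by
  unfold srcMap
  split
  · simp; omega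
  · rw [Option.some_inj, Fin.ext_iff]
    simp only
    omega

theorem tracked_carrier {z q α : ℕ} (h : P.carrier z q α < P.s) :
    P.Tracked z q (P.carrier z q α) α := first_spec (p := fun x => P.Tracked z q x α) h

theorem carrier_lt {z q x α : ℕ} (hx : x < P.s) (h : P.Tracked z q x α) :
    P.carrier z q α < P.s := first_lt (p := fun x => P.Tracked z q x α) hx h

theorem wellFormed_trans (ha : 0 < P.a) (q : Fin P.states) (z : ℕ) :
    (P.trans ha q z).WellFormed := by
  refine ⟨fun e he => ?_, fun r u hu => ?_⟩
  · simp only [trans, guard] at he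
    split at he
    · obtain ⟨φ, hφ, he⟩ := mem_atoms_conj he
      simp only [List.mem_append, List.mem_flatMap, List.mem_map] at hφ
      rcases hφ with ⟨k, -, l, -, rfl⟩ | ⟨x, -, r, -, rfl⟩
      · unfold partFormula at he
        split at he <;>
        · simp only [BoolFormula.atoms, Set.mem_singleton_iff] at he
          subst he
          exact ⟨trivial, trivial⟩
      · unfold regFormula at he
        split at he
        · rename_i hx
          split at he
          · simp only [BoolFormula.atoms, Set.mem_singleton_iff] at he
            subst he
            exact ⟨P.srcMap_isSome hx.1, trivial⟩
          · split at he
            · rename_i h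
              simp only [BoolFormula.atoms, Set.mem_singleton_iff] at he
              subst he
              exact ⟨P.srcMap_isSome hx.1, P.srcMap_isSome (P.tracked_carrier h).1⟩
            · simp [BoolFormula.atoms] at he
        · simp [BoolFormula.atoms] at he
    · simp [BoolFormula.atoms] at he
  · simp only [trans, update] at hu
    split at hu
    · cases hu
      trivial
    · split at hu
      · rename_i h
        cases hu
        exact P.srcMap_isSome (P.tracked_carrier h).1
      · cases hu
        trivial

/-- The automaton that guesses spheres. A state is locally final for `x` if no sphere that it
records requires an `x`-successor. -/
noncomputable def automaton (ha : 0 < P.a) :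
    CRA (Fin P.a) (Fin P.s) (Fin P.states) (Fin P.regs) P.m where
  trans := (List.finRange P.states).flatMap fun q =>
    (List.range P.sources).map fun z => P.trans ha q z
  wf t ht := by
    simp only [List.mem_flatMap, List.mem_map] at ht
    obtain ⟨q, -, z, -, rfl⟩ := ht
    exact P.wellFormed_trans ha q z
  locFinal x := {q | P.NoOut q x}
  acc := .tru

open Classical in
/-- The colours of the nodes of the graph attached to `q`, in increasing order. -/
noncomputable def nodes (q : ℕ) : List ℕ := (List.range P.colours).filter (fun α => P.IsNode q α)

/-- The position of the own colour among the nodes. -/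
noncomputable def centerIndex (q : ℕ) : ℕ := ∑ α ∈ Finset.range (P.own q), bitOf (P.IsNode q α)

theorem isNode_own (q : ℕ) : P.IsNode q (P.own q) := by
  by_cases h : P.SphereOK (P.sph q (P.own q)) (P.own q)
  · exact .inl ⟨h, by rw [InV, h.1]; exact Nat.zero_le _⟩
  · exact .inr ⟨h, rfl⟩

theorem mem_nodes {q α : ℕ} : α ∈ P.nodes q ↔ α < P.colours ∧ P.IsNode q α := by
  simp [nodes]

open Classical in
theorem length_filter_range (n : ℕ) (p : ℕ → Prop) :
    ((List.range n).filter (fun i => p i)).length = ∑ i ∈ Finset.range n, bitOf (p i) := by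
  induction n with
  | zero => simp
  | succ n ih =>
    rw [List.range_succ, List.filter_append, List.length_append, ih, Finset.sum_range_succ]
    by_cases h : p n <;> simp [h, bitOf]

theorem length_nodes (q : ℕ) :
    (P.nodes q).length = ∑ α ∈ Finset.range P.colours, bitOf (P.IsNode q α) :=
  length_filter_range _ _

theorem nodes_getElem? (q : ℕ) : (P.nodes q)[P.centerIndex q]? = some (P.own q) := by
  classical
  obtain ⟨d, hd⟩ := Nat.exists_eq_add_of_lt (P.own_lt q)
  have hr : List.range P.colours =
      List.range (P.own q) ++ P.own q :: (List.range d).map (fun i => P.own q + 1 + i) := by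
    rw [hd, Nat.add_right_comm, List.range_add, List.range_succ]
    simp
  rw [nodes, hr, List.filter_append, List.filter_cons_of_pos (by simpa using P.isNode_own q),
    centerIndex, ← length_filter_range]
  simp

theorem centerIndex_lt (q : ℕ) : P.centerIndex q < (P.nodes q).length :=
  (List.getElem?_eq_some_iff.1 (P.nodes_getElem? q)).1

theorem nodes_centerIndex (q : ℕ) :
    (P.nodes q)[P.centerIndex q]'(P.centerIndex_lt q) = P.own q :=
  (List.getElem?_eq_some_iff.1 (P.nodes_getElem? q)).2

theorem nodes_injective (q : ℕ) : Function.Injective (P.nodes q).get :=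
  List.nodup_iff_injective_get.1 (List.Nodup.filter _ List.nodup_range)

/-- The graph attached to the state `q`: the own sphere of `q`, with the nodes numbered in the
order of their colours. -/
noncomputable def stateGraph (ha : 0 < P.a) (q : ℕ) :
    PointedGraph (Fin P.a) (Fin P.s) P.m (Fin (P.nodes q).length) :=
    { edge := fun x u v =>
        P.Edge (P.sph q (P.own q)) x ((P.nodes q).get u) ((P.nodes q).get v)
      label := fun u => ⟨P.lab (P.sph q (P.own q)) ((P.nodes q).get u) % P.a, Nat.mod_lt _ ha⟩
      part := fun u =>
        Setoid.ker fun k : Fin P.m => P.cls (P.sph q (P.own q)) ((P.nodes q).get u) k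
      out_unique := fun x i j k h h' => P.nodes_injective q (by
        unfold Edge at h h'
        omega)
      in_unique := fun x i j k h h' => P.nodes_injective q (by
        have hi := P.mem_nodes.1 ((P.nodes q).get_mem i)
        have hj := P.mem_nodes.1 ((P.nodes q).get_mem j)
        have hk := P.mem_nodes.1 ((P.nodes q).get_mem k)
        by_cases hS : P.SphereOK (P.sph q (P.own q)) (P.own q)
        · simp only [IsNode, hS, true_and, not_true, false_and, or_false] at hi hj hk
          exact ((hS.2.2.2 x x.2 _ hk.1 hk.2 _ hi.1 hi.2 h').2.2 _ hj.1 hj.2 h)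
        · simp only [IsNode, hS, false_and, not_false_iff, true_and, false_or] at hj hk
          rw [hj.2, hk.2])
      center := ⟨P.centerIndex q, P.centerIndex_lt q⟩ }

theorem isSphere_stateGraph (ha : 0 < P.a) (q : ℕ) : (P.stateGraph ha q).IsSphere P.B := by
  set T := P.stateGraph ha q
  have hcenter : (P.nodes q).get T.center = P.own q := P.nodes_centerIndex q
  have hdist : ∀ u, T.DistLE P.B T.center u := by
    by_cases hS : P.SphereOK (P.sph q (P.own q)) (P.own q)
    · have hnode : ∀ u, P.InV (P.sph q (P.own q)) ((P.nodes q).get u) := fun u => by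
        have h := (P.mem_nodes.1 ((P.nodes q).get_mem u)).2
        simpa only [IsNode, hS, true_and, not_true, false_and, or_false] using h
      have key : ∀ d u, P.lev (P.sph q (P.own q)) ((P.nodes q).get u) = d →
          T.DistLE d T.center u := by
        intro d
        induction d with
        | zero =>
          intro u hu
          have h := P.mem_nodes.1 ((P.nodes q).get_mem u)
          have := hS.2.1 _ h.1 (hnode u) hu
          rw [← hcenter] at this
          exact Dist.zero_iff.2 (P.nodes_injective q this.symm)
        | succ d ih =>
          intro u hu
          have h := P.mem_nodes.1 ((P.nodes q).get_mem u)
          obtain ⟨β, hβ, hlev, x, hx, hedge⟩ := hS.2.2.1 _ h.1 (hnode u) (by omega)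
          have hβn : β ∈ P.nodes q := P.mem_nodes.2 ⟨hβ, .inl ⟨hS, by
            have := hnode u
            unfold InV at this ⊢
            omega⟩⟩
          obtain ⟨v, rfl⟩ := List.get_of_mem hβn
          refine Dist.trans (ih v (by omega)) ?_
          rcases hedge with hedge | hedge
          · exact Dist.symm (Dist.of_edge (G := T.toSGraph) (x := ⟨x, hx⟩) hedge)
          · exact Dist.of_edge (G := T.toSGraph) (x := ⟨x, hx⟩) hedge
      exact fun u => Dist.mono (key _ u rfl) (hnode u)
    · intro u
      have h := (P.mem_nodes.1 ((P.nodes q).get_mem u)).2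
      simp only [IsNode, hS, false_and, not_false_iff, true_and, false_or] at h
      rw [← hcenter] at h
      rw [P.nodes_injective q h]
      exact Dist.refl _ _
  exact ⟨Fin (P.nodes q).length, inferInstance, T.toSGraph, T.center,
    (Equiv.subtypeUnivEquiv hdist).symm, fun _ _ _ => Iff.rfl, fun _ => rfl, fun _ => rfl, rfl⟩

end Par
end SphereCRA

namespace SphereCRA

/-! ### The description of the automaton is printed in elementary time -/

theorem map_finRange {β : Type*} {n : ℕ} {f : Fin n → β} {F : ℕ → β} (h : ∀ i, f i = F i) :
    (List.finRange n).map f = (List.range n).map F := by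
  rw [← List.map_coe_finRange_eq_range, List.map_map]
  exact List.map_congr_left fun i _ => h i

theorem flatMap_finRange {β : Type*} {n : ℕ} {f : Fin n → List β} {F : ℕ → List β}
    (h : ∀ i, f i = F i) : (List.finRange n).flatMap f = (List.range n).flatMap F := by
  rw [List.flatMap_def, List.flatMap_def, map_finRange h]

theorem flatMap_get {β γ : Type*} (l : List β) (F : β → List γ) :
    (List.finRange l.length).flatMap (fun i => F (l.get i)) = l.flatMap F := by
  conv_rhs => rw [← List.map_get_finRange l]
  rw [List.flatMap_map]

theorem flatMap_filter_eq {β γ : Type*} (l : List β) (p : β → Prop) [DecidablePred p]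
    (F : β → List γ) :
    (l.filter fun i => p i).flatMap F = l.flatMap fun i => if p i then F i else [] := by
  induction l with
  | nil => simp
  | cons i l ih => by_cases h : p i <;> simp [h, ih]

namespace Par

variable (P : Par)

open Classical in
/-- The tokens of the equality formulas of the guard. -/
noncomputable def partTokens (q k l : ℕ) : List ℕ :=
  if P.cls (P.sph q (P.own q)) (P.own q) k = P.cls (P.sph q (P.own q)) (P.own q) l then
    [2, 0, k, 0, l] else [3, 2, 0, k, 0, l]

open Classical in
/-- The tokens of the register formulas of the guard. -/
noncomputable def regTokens (z q x r : ℕ) : List ℕ :=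
  if P.Tracked z q x (P.regColour r) then
    if P.regColour r = P.own q then [2, 1, x, r, 0, r % P.m]
    else if P.carrier z q (P.regColour r) < P.s then
      [2, 1, x, r, 1, P.carrier z q (P.regColour r), r]
    else [0]
  else [0]

open Classical in
/-- The tokens of the guard. -/
noncomputable def guardTokens (z q : ℕ) : List ℕ :=
  if P.TransOK z q then
    (List.range P.m).flatMap (fun k => (List.range P.m).flatMap fun l =>
      5 :: P.partTokens q k l) ++
    ((List.range P.s).flatMap (fun x => (List.range P.regs).flatMap fun r =>
      5 :: P.regTokens z q x r) ++ [0])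
  else [1]

open Classical in
/-- The tokens of the update of a register. -/
noncomputable def registerUpdateTokens (z q r : ℕ) : List ℕ :=
  if P.regColour r = P.own q then [2, r % P.m, 0]
  else if P.carrier z q (P.regColour r) < P.s then [1, P.carrier z q (P.regColour r), r]
  else [2, r % P.m, 2 * P.B]

/-- The tokens of a transition. -/
noncomputable def transTokens (q z : ℕ) : List ℕ :=
  (List.range P.s).map (P.src z) ++ (P.guardTokens z q ++
    (P.lab (P.sph q (P.own q)) (P.own q) % P.a :: q ::
      (List.range P.regs).flatMap (P.registerUpdateTokens z q)))

/-- Apply `F` to the nodes of the graph of a state. -/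
noncomputable def forNodes (q : ℕ) (F : ℕ → List ℕ) : List ℕ := by
  classical
  exact (List.range P.colours).flatMap fun α => if P.IsNode q α then F α else []

/-- The tokens of the graph of a state. -/
noncomputable def graphTokens (q : ℕ) : List ℕ :=
  (∑ α ∈ Finset.range P.colours, bitOf (P.IsNode q α)) :: P.centerIndex q ::
  ((List.range P.s).flatMap (fun x => P.forNodes q fun α => P.forNodes q fun β =>
      [bitOf (P.Edge (P.sph q (P.own q)) x α β)]) ++
    (P.forNodes q (fun α => [P.lab (P.sph q (P.own q)) α % P.a]) ++
      P.forNodes q fun α => (List.range P.m).flatMap fun k => (List.range P.m).map fun l =>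
        bitOf (P.cls (P.sph q (P.own q)) α k = P.cls (P.sph q (P.own q)) α l)))

/-- The tokens of the automaton and of the map from states to graphs. -/
noncomputable def allTokens : List ℕ :=
  P.states :: P.regs :: P.states * P.sources ::
  ((List.range P.states).flatMap (fun q => (List.range P.sources).flatMap (P.transTokens q)) ++
    ((List.range P.s).flatMap (fun x => (List.range P.states).map fun q => bitOf (P.NoOut q x)) ++
      (0 :: (List.range P.states).flatMap P.graphTokens)))

theorem tokens_partFormula (q : ℕ) (k l : Fin P.m) :
    (P.partFormula q k l).tokens (fun e => e.1.tokens ++ e.2.tokens) =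
      P.partTokens q k l := by
  unfold partFormula partTokens
  split <;> simp [BoolFormula.tokens, GuardTerm.tokens]

theorem tokens_regFormula (z q : ℕ) (x : Fin P.s) (r : Fin P.regs) :
    (P.regFormula z q x r).tokens (fun e => e.1.tokens ++ e.2.tokens) =
      P.regTokens z q x r := by
  unfold regFormula regTokens
  split
  · split
    · simp [BoolFormula.tokens, GuardTerm.tokens, regIndex]
    · split <;> simp [BoolFormula.tokens, GuardTerm.tokens]
  · simp [BoolFormula.tokens]

theorem tokens_guard (z q : ℕ) :
    (P.guard z q).tokens (fun e => e.1.tokens ++ e.2.tokens) = P.guardTokens z q := by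
  unfold guard guardTokens
  split
  · rw [tokens_conj, List.flatMap_append, List.flatMap_assoc, List.flatMap_assoc,
      List.append_assoc]
    congr 1
    · exact flatMap_finRange fun k => by
        rw [List.flatMap_map]
        exact flatMap_finRange fun l => by rw [tokens_partFormula]
    · congr 1
      exact flatMap_finRange fun k => by
        rw [List.flatMap_map]
        exact flatMap_finRange fun l => by rw [tokens_regFormula]
  · rfl

theorem updateTokens_update (z q : ℕ) (r : Fin P.regs) :
    updateTokens (P.update z q r) = P.registerUpdateTokens z q r := by
  unfold update registerUpdateTokens
  split
  · rfl
  · split <;> rfl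

theorem tokens_trans (ha : 0 < P.a) (q : Fin P.states) (z : ℕ) :
    (P.trans ha q z).tokens = P.transTokens q z := by
  unfold CRATransition.tokens transTokens
  rw [List.append_assoc, List.append_assoc]
  congr 1
  · refine map_finRange fun x => ?_
    simp only [trans, srcMap]
    split
    · simp [sourceToken, *]
    · simp only [sourceToken]
      omega
  · congr 1
    · exact P.tokens_guard z q
    · simp only [List.cons_append, List.nil_append]
      congr 2
      exact flatMap_finRange fun r => P.updateTokens_update z q r

theorem flatMap_nodes (q : ℕ) (F : ℕ → List ℕ) :
    (P.nodes q).flatMap F = P.forNodes q F := by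
  classical
  unfold nodes forNodes
  exact flatMap_filter_eq _ (P.IsNode q) _

theorem flatMap_fin_nodes (q : ℕ) (F : ℕ → List ℕ) :
    (List.finRange (P.nodes q).length).flatMap (fun u => F ((P.nodes q).get u)) =
      P.forNodes q F := by
  rw [flatMap_get, flatMap_nodes]

theorem map_fin_nodes (q : ℕ) (F : ℕ → ℕ) :
    (List.finRange (P.nodes q).length).map (fun u => F ((P.nodes q).get u)) =
      P.forNodes q (fun α => [F α]) := by
  rw [← flatMap_fin_nodes]
  exact (List.flatMap_pure_eq_map _ _).symm

theorem tokens_stateGraph (ha : 0 < P.a) (q : ℕ) :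
    FinPointedGraph.tokens ⟨_, P.stateGraph ha q⟩ = P.graphTokens q := by
  unfold FinPointedGraph.tokens graphTokens
  rw [← length_nodes, List.append_assoc, List.append_assoc, List.cons_append, List.cons_append,
    List.nil_append]
  refine congrArg₂ List.cons rfl (congrArg₂ List.cons rfl (congrArg₂ (· ++ ·) ?_
    (congrArg₂ (· ++ ·) ?_ ?_)))
  · refine flatMap_finRange fun x => ?_
    rw [← flatMap_fin_nodes]
    refine congrArg (fun f => List.flatMap f _) (funext fun u => ?_)
    rw [← map_fin_nodes]
    rfl
  · rw [← map_fin_nodes]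
    rfl
  · rw [← flatMap_fin_nodes]
    refine congrArg (fun f => List.flatMap f _) (funext fun u => ?_)
    exact flatMap_finRange fun k => map_finRange fun l => rfl

theorem descriptionTokens_automaton (ha : 0 < P.a) :
    descriptionTokens (P.automaton ha) (fun q => ⟨_, P.stateGraph ha q⟩) = P.allTokens := by
  unfold descriptionTokens CRA.tokens allTokens
  simp only [List.append_assoc, List.cons_append, List.nil_append]
  refine congrArg₂ List.cons rfl (congrArg₂ List.cons rfl (congrArg₂ List.cons ?_
    (congrArg₂ (· ++ ·) ?_ (congrArg₂ (· ++ ·) ?_ (congrArg₂ List.cons rfl ?_)))))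
  · simp [automaton, List.length_flatMap, List.map_const']
  · simp only [automaton]
    rw [List.flatMap_assoc]
    refine flatMap_finRange fun q => ?_
    rw [List.flatMap_map]
    simp only [tokens_trans]
  · exact flatMap_finRange fun x => map_finRange fun q => rfl
  · exact flatMap_finRange fun q => P.tokens_stateGraph ha q

end Par

variable {α : Type} [Env α]

namespace ElemPar

variable {p : α → Par} {K L q z X R : α → ℕ}

/-- Division is available for positive divisors only, whereas there may be no data values. -/
theorem regColour_eq (P : Par) (r : ℕ) :
    P.regColour r = if P.m = 0 then 0 else r / (P.m + (1 - P.m)) := by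
  unfold Par.regColour
  split
  · simp [*]
  · rw [show P.m + (1 - P.m) = P.m by omega]

theorem regColour (hp : ElemPar p) (hR : Elem R) : Elem (fun v => (p v).regColour (R v)) := by
  simp only [regColour_eq]
  exact Elem.ite (ElemPred.eq hp.m (.const 0)) (.const 0)
    (hR.div (hp.m.add ((Elem.const 1).sub hp.m)) fun v => by omega)

theorem regIndex_eq (P : Par) (r : ℕ) : r % P.m = r - P.m * P.regColour r := by
  have := Nat.mod_add_div r P.m
  unfold Par.regColour
  omega

theorem regIndex (hp : ElemPar p) (hR : Elem R) : Elem (fun v => R v % (p v).m) := by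
  simp only [regIndex_eq]
  exact hR.sub (hp.m.mul (hp.regColour hR))

theorem partTokens (hp : ElemPar p) (hq : Elem q) (hK : Elem K) (hL : Elem L) :
    Emits (fun v => (p v).partTokens (q v) (K v) (L v)) := by
  have hS := hp.sph hq (hp.own hq)
  have h : Emits (fun v => [2, 0, K v, 0, L v]) := .cons (.const 2) (.cons (.const 0)
    (.cons hK (.cons (.const 0) (.singleton hL))))
  exact Emits.ite (ElemPred.eq (hp.cls hS (hp.own hq) hK) (hp.cls hS (hp.own hq) hL)) h
    (.cons (.const 3) h)

theorem regTokens (hp : ElemPar p) (hz : Elem z) (hq : Elem q) (hX : Elem X) (hR : Elem R) :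
    Emits (fun v => (p v).regTokens (z v) (q v) (X v) (R v)) := by
  have hc := hp.regColour hR
  have hk := hp.carrier hz hq hc
  classical
  exact Emits.ite (hp.tracked hz hq hX hc)
    (Emits.ite (ElemPred.eq hc (hp.own hq))
      (.cons (.const 2) (.cons (.const 1) (.cons hX (.cons hR (.cons (.const 0)
        (.singleton (hp.regIndex hR)))))))
      (Emits.ite (ElemPred.lt hk hp.s)
        (.cons (.const 2) (.cons (.const 1) (.cons hX (.cons hR (.cons (.const 1)
          (.cons hk (.singleton hR)))))))
        (.singleton (.const 0))))
    (.singleton (.const 0))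

theorem guardTokens (hp : ElemPar p) (hz : Elem z) (hq : Elem q) :
    Emits (fun v => (p v).guardTokens (z v) (q v)) := by
  have hp1 := hp.weaken
  have hp2 := hp1.weaken
  classical
  exact Emits.ite (hp.transOK hz hq)
    ((Emits.flatMap hp.m (Emits.flatMap hp1.m (.cons (.const 5)
      (hp2.partTokens hq.weaken.weaken (Elem.weaken .fst) .fst)))).append
    ((Emits.flatMap hp.s (Emits.flatMap hp1.regs (.cons (.const 5)
      (hp2.regTokens hz.weaken.weaken hq.weaken.weaken (Elem.weaken .fst) .fst)))).append
      (.singleton (.const 0))))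
    (.singleton (.const 1))

theorem registerUpdateTokens (hp : ElemPar p) (hz : Elem z) (hq : Elem q) (hR : Elem R) :
    Emits (fun v => (p v).registerUpdateTokens (z v) (q v) (R v)) := by
  have hc := hp.regColour hR
  have hk := hp.carrier hz hq hc
  exact Emits.ite (ElemPred.eq hc (hp.own hq))
    (.cons (.const 2) (.cons (hp.regIndex hR) (.singleton (.const 0))))
    (Emits.ite (ElemPred.lt hk hp.s)
      (.cons (.const 1) (.cons hk (.singleton hR)))
      (.cons (.const 2) (.cons (hp.regIndex hR) (.singleton ((Elem.const 2).mul hp.B)))))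

theorem transTokens (ha : ∀ v, 0 < (p v).a) (hp : ElemPar p) (hq : Elem q) (hz : Elem z) :
    Emits (fun v => (p v).transTokens (q v) (z v)) := by
  have hp1 := hp.weaken
  exact (Emits.map hp.s (hp1.src hz.weaken .fst)).append ((hp.guardTokens hz hq).append
    (.cons ((hp.lab (hp.sph hq (hp.own hq)) (hp.own hq)).mod hp.a ha) (.cons hq
      (Emits.flatMap hp.regs (hp1.registerUpdateTokens hz.weaken hq.weaken .fst)))))

theorem forNodes {F : ℕ → α → List ℕ} (hp : ElemPar p) (hq : Elem q)
    (hF : Emits (fun v : ℕ × α => F v.1 v.2)) :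
    Emits (fun v => (p v).forNodes (q v) (fun i => F i v)) := by
  classical
  exact Emits.flatMap (F := fun i v => if (p v).IsNode (q v) i then F i v else []) hp.colours
    (Emits.ite (hp.weaken.isNode hq.weaken .fst) hF .nil)

theorem graphTokens (ha : ∀ v, 0 < (p v).a) (hp : ElemPar p) (hq : Elem q) :
    Emits (fun v => (p v).graphTokens (q v)) := by
  have hp1 := hp.weaken
  have hp2 := hp1.weaken
  have hp3 := hp2.weaken
  have hq1 := hq.weaken
  have hq2 := hq1.weaken
  have hq3 := hq2.weaken
  have hS1 := hp1.sph hq1 (hp1.own hq1)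
  have hS3 := hp3.sph hq3 (hp3.own hq3)
  refine .cons (Elem.sum hp.colours (hp1.isNode hq1 .fst)) (.cons
    (Elem.sum (hp.own hq) (hp1.isNode hq1 .fst)) (Emits.append (Emits.flatMap hp.s
      (hp1.forNodes hq1 (hp2.forNodes hq2 (.singleton ?_))))
    (Emits.append (hp.forNodes hq (.singleton ((hp1.lab hS1 .fst).mod hp1.a fun v => ha v.2)))
      (hp.forNodes hq (Emits.flatMap hp1.m (Emits.map hp2.m ?_))))))
  · exact hp3.edge hS3 (Elem.weaken (Elem.weaken .fst)) (Elem.weaken .fst) .fst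
  · exact ElemPred.eq (hp3.cls hS3 (Elem.weaken (Elem.weaken .fst)) (Elem.weaken .fst))
      (hp3.cls hS3 (Elem.weaken (Elem.weaken .fst)) .fst)

theorem allTokens (ha : ∀ v, 0 < (p v).a) (hp : ElemPar p) :
    Emits (fun v => (p v).allTokens) := by
  have hp1 := hp.weaken
  have hp2 := hp1.weaken
  exact .cons hp.states (.cons hp.regs (.cons (hp.states.mul hp.sources) (Emits.append
    (Emits.flatMap hp.states (Emits.flatMap hp1.sources
      (hp2.transTokens (fun v => ha v.2.2) (Elem.weaken .fst) .fst)))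
    (Emits.append (Emits.flatMap hp.s (Emits.map hp1.states
      (hp2.noOut .fst (Elem.weaken .fst))))
      (.cons (.const 0) (Emits.flatMap hp.states
        (hp1.graphTokens (fun v => ha v.2) .fst)))))))

end ElemPar

/-- The parameters with the number of letters made positive, so that the program is total. -/
def posPar (P : Par) : Par := ⟨P.B, P.s, P.a + (1 - P.a), P.m⟩

/-- A single program prints the descriptions for all parameters, in elementary time. -/
theorem exists_code : ∃ (c : Turing.ToPartrec.Code) (h : ℕ), ∀ P : Par, 0 < P.a →
    ComputesInTime c [P.B, P.s, P.a, P.m] P.allTokens (tower h (P.B + P.s + P.a + P.m)) := by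
  have hid := elemPar_id
  have hpos : ElemPar posPar :=
    ⟨hid.B, hid.s, hid.a.add ((Elem.const 1).sub hid.a), hid.m⟩
  obtain ⟨c, T, hT, hc⟩ := hpos.allTokens (fun P => by simp only [posPar]; omega)
  obtain ⟨h, hh⟩ := hT.add (.const 6)
  refine ⟨(tails 4).comp c, h, fun P ha => ?_⟩
  have hP : posPar P = P := by
    obtain ⟨B, s, a, m⟩ := P
    simp only [posPar, Par.mk.injEq, true_and, and_true] at ha ⊢
    omega
  have h1 := (hc P []).comp (Runs.tails 4 _)
  simp only [hP] at h1
  obtain ⟨n, hn, h1⟩ := h1 Turing.ToPartrec.Cont.halt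
  have h2 := hh P
  have h3 : size P = P.B + P.s + P.a + P.m := by
    simp [size, Env.toList]
    omega
  rw [h3] at h2
  refine ⟨⟨⟨n, ?_⟩, hn.trans h2⟩⟩
  simpa [Env.toList, Turing.ToPartrec.stepRet] using h1

theorem exists_bound (f : Par → ℕ) (hf : Elem f) :
    ∃ h, ∀ P : Par, f P ≤ tower h (P.B + P.s + P.a + P.m) := by
  obtain ⟨h, hh⟩ := hf.towerBounded
  refine ⟨h, fun P => (hh P).trans_eq ?_⟩
  congr 1
  simp [size, Env.toList]
  omega

end SphereCRA

namespace SphereCRA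

/-! ### Accepting runs guess the spheres correctly -/

namespace Par

variable {P : Par} {D : Type*} {I : Signature (Fin P.a) D (Fin P.s) P.m}
  {w : DataWord (Fin P.a) D P.m} {ξ : ConfigSeq (Fin P.states) (Fin P.regs) w}

/-- There is a register for every colour and every data index. -/
theorem exists_reg {α : ℕ} (hα : α < P.colours) (k : Fin P.m) :
    ∃ r : Fin P.regs, P.regColour r = α ∧ P.regIndex r = k := by
  have h : (α + 1) * P.m ≤ P.colours * P.m := Nat.mul_le_mul_right _ hα
  have hk := k.2
  rw [Nat.add_mul] at h
  refine ⟨⟨P.m * α + k, by rw [regs, Nat.mul_comm]; omega⟩, ?_, Fin.ext ?_⟩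
  · simp only [regColour]
    rw [Nat.mul_add_div k.pos, Nat.div_eq_of_lt k.2, Nat.add_zero]
  · simp only [regIndex]
    rw [Nat.mul_add_mod, Nat.mod_eq_of_lt k.2]

/-- The local conditions that hold at every position of an accepting run. -/
structure Consistent (P : Par) {D : Type*} (I : Signature (Fin P.a) D (Fin P.s) P.m)
    (w : DataWord (Fin P.a) D P.m) (ξ : ConfigSeq (Fin P.states) (Fin P.regs) w) : Prop where
  sphereOK : ∀ j, P.SphereOK (P.sph (ξ j).1 (P.own (ξ j).1)) (P.own (ξ j).1)
  agreeOK : ∀ j, P.AgreeOK (ξ j).1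
  label : ∀ j, ((w.get j).1 : ℕ) = P.lab (P.sph (ξ j).1 (P.own (ξ j).1)) (P.own (ξ j).1) % P.a
  part : ∀ j (k l : Fin P.m), P.cls (P.sph (ξ j).1 (P.own (ξ j).1)) (P.own (ξ j).1) k =
    P.cls (P.sph (ξ j).1 (P.own (ξ j).1)) (P.own (ξ j).1) l ↔ (w.get j).2 k = (w.get j).2 l
  link : ∀ x i j, I.rel w x i j → P.Link (ξ i).1 (ξ j).1 x
  noIn : ∀ x j, (¬ ∃ i, I.rel w x i j) → P.NoIn (ξ j).1 x
  noOut : ∀ x j, (¬ ∃ i, I.rel w x j i) → P.NoOut (ξ j).1 x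
  reg_own : ∀ j (r : Fin P.regs), P.regColour r = P.own (ξ j).1 →
    (ξ j).2 r = some ((w.get j).2 (P.regIndex r))
  reg_eq : ∀ x i j (r : Fin P.regs), I.rel w x i j →
    P.Shares (ξ i).1 (ξ j).1 (P.regColour r) → (ξ i).2 r = (ξ j).2 r

theorem Consistent.of_accepting {ha : 0 < P.a} (hacc : (P.automaton ha).IsAcceptingRun I w ξ) :
    P.Consistent I w ξ := by
  have key : ∀ j, ∃ z, (P.trans ha (ξ j).1 z).ExecAt I w ξ j := fun j => by
    obtain ⟨t, ht, hex⟩ := hacc.1 j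
    simp only [automaton, List.mem_flatMap, List.mem_map] at ht
    obtain ⟨q, -, z, -, rfl⟩ := ht
    obtain rfl : q = (ξ j).1 := hex.2.1
    exact ⟨z, hex⟩
  choose z hz using key
  have hguard : ∀ j, P.TransOK (z j) (ξ j).1 ∧
      (∀ k l, (P.partFormula (ξ j).1 k l).Eval
        (fun e => ∃ d, TermVal I w ξ j e.1 d ∧ TermVal I w ξ j e.2 d)) ∧
      ∀ x r, (P.regFormula (z j) (ξ j).1 x r).Eval
        (fun e => ∃ d, TermVal I w ξ j e.1 d ∧ TermVal I w ξ j e.2 d) := fun j => by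
    obtain ⟨-, -, -, -, hg, -⟩ := hz j
    simp only [trans, guard] at hg
    split at hg
    · rename_i hok
      rw [eval_conj] at hg
      refine ⟨hok, fun k l => hg _ ?_, fun x r => hg _ ?_⟩
      · simp only [List.mem_append, List.mem_flatMap, List.mem_map]
        exact .inl ⟨k, List.mem_finRange _, l, List.mem_finRange _, rfl⟩
      · simp only [List.mem_append, List.mem_flatMap, List.mem_map]
        exact .inr ⟨x, List.mem_finRange _, r, List.mem_finRange _, rfl⟩
    · exact absurd hg id
  have hsrc : ∀ x i j, I.rel w x i j → P.src (z j) x = (ξ i).1 + 1 := fun x i j h =>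
    P.srcMap_eq_some.1 ((hz j).2.2.2.1 x i h)
  have hsrc0 : ∀ x j, (¬ ∃ i, I.rel w x i j) → P.src (z j) x = 0 := fun x j h => by
    by_contra hne
    exact h (((hz j).2.2.1 x).1 (P.srcMap_isSome hne))
  have hown : ∀ j (r : Fin P.regs), P.regColour r = P.own (ξ j).1 →
      (ξ j).2 r = some ((w.get j).2 (P.regIndex r)) := fun j r hr => by
    have hu := (hz j).2.2.2.2.2 r
    simp only [trans, update, hr, if_true] at hu
    obtain ⟨j', hj', hu⟩ := hu
    rw [Dist.zero_iff] at hj'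
    subst hj'
    exact hu
  refine ⟨fun j => (hguard j).1.1, fun j => (hguard j).1.2.1, fun j => ?_, fun j k l => ?_,
    fun x i j h => ?_, fun x j h => ?_, fun x j h => hacc.2.1 j x h, hown,
    fun x i j r h hsh => ?_⟩
  · rw [← (hz j).1]
    rfl
  · have h := (hguard j).2.1 k l
    unfold partFormula at h
    split at h
    · rename_i hc
      obtain ⟨d, h1, h2⟩ := h
      exact ⟨fun _ => h1.trans h2.symm, fun _ => hc⟩
    · rename_i hc
      exact ⟨fun h' => absurd h' hc, fun h' => absurd ⟨_, h', rfl⟩ h⟩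
  · have h1 := hsrc x i j h
    have h2 := ((hguard j).1.2.2 x x.2).2 (by omega)
    rwa [h1, Nat.add_sub_cancel] at h2
  · exact ((hguard j).1.2.2 x x.2).1 (hsrc0 x j h)
  · have h1 := hsrc x i j h
    have htr : P.Tracked (z j) (ξ j).1 x (P.regColour r) :=
      ⟨by omega, by rwa [h1, Nat.add_sub_cancel]⟩
    have hf := (hguard j).2.2 x r
    simp only [regFormula, htr, if_true] at hf
    by_cases hr : P.regColour r = P.own (ξ j).1
    · rw [if_pos hr] at hf
      obtain ⟨d, ⟨i', hi', hd⟩, hd'⟩ := hf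
      obtain rfl := I.in_unique w x _ _ _ h hi'
      rw [hown j r hr, hd]
      exact congrArg some hd'.symm
    · have hlt := P.carrier_lt x.2 htr
      have hu := (hz j).2.2.2.2.2 r
      simp only [trans, update, hr, if_false, hlt, dite_true] at hu hf
      obtain ⟨i₁, hi₁, hu⟩ := hu
      obtain ⟨d, ⟨i', hi', hd⟩, ⟨i₂, hi₂, hd₂⟩⟩ := hf
      obtain rfl := I.in_unique w x _ _ _ h hi'
      obtain rfl := I.in_unique w _ _ _ _ hi₁ hi₂
      rw [hu, hd, hd₂]

/-- The position `j` claims to be the node of colour `α` in the sphere `S` with center colour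
`γ`, and it knows the data values given by `ρ` of all nodes of this sphere. -/
def Claims (P : Par) {D : Type*} {w : DataWord (Fin P.a) D P.m}
    (ξ : ConfigSeq (Fin P.states) (Fin P.regs) w) (S γ : ℕ) (ρ : Fin P.regs → Option D)
    (α : ℕ) (j : Fin w.length) : Prop :=
  P.own (ξ j).1 = α ∧ P.sph (ξ j).1 γ = S ∧
    ∀ r : Fin P.regs, P.InV S (P.regColour r) → (ξ j).2 r = ρ r

variable {S γ α β : ℕ} {ρ : Fin P.regs → Option D} {x : Fin P.s} {j j' : Fin w.length}

namespace Consistent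

/-- Two positions that claim to be the same node of the same sphere carry the same letter and the
same data values, so that the interpretation is monotone on them. -/
theorem get_eq (hc : P.Consistent I w ξ) (hγ : γ < P.colours) (hα : P.InV S α)
    (h : P.Claims ξ S γ ρ α j) (h' : P.Claims ξ S γ ρ α j') : w.get j = w.get j' := by
  have key : ∀ {j}, P.Claims ξ S γ ρ α j → ((w.get j).1 : ℕ) = P.lab S α % P.a ∧
      ∀ r : Fin P.regs, P.regColour r = α → ρ r = some ((w.get j).2 (P.regIndex r)) := by
    intro j hj
    obtain ⟨rfl, rfl, hreg⟩ := hj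
    refine ⟨?_, fun r hr => ?_⟩
    · rw [hc.label j, (hc.agreeOK j γ hγ hα).1]
    · rw [← hreg _ (by rwa [hr]), hc.reg_own _ _ hr]
  refine Prod.ext (Fin.ext ((key h).1.trans (key h').1.symm)) (funext fun k => ?_)
  obtain ⟨r, hr, rfl⟩ := exists_reg (h.1 ▸ P.own_lt _ : α < P.colours) k
  exact Option.some.inj (((key h).2 r hr).symm.trans ((key h').2 r hr))

/-- The two ends of an edge that see a common sphere hold the same registers for its nodes. -/
theorem claims_iff (hc : P.Consistent I w ξ) (hγ : γ < P.colours)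
    (hrel : I.rel w x j j') (hj : P.Active (ξ j).1 γ) (hj' : P.Active (ξ j').1 γ)
    (hS : P.sph (ξ j).1 γ = S) (hS' : P.sph (ξ j').1 γ = S) :
    P.Claims ξ S γ ρ (P.own (ξ j).1) j ↔ P.Claims ξ S γ ρ (P.own (ξ j').1) j' := by
  have hreg : ∀ r : Fin P.regs, P.InV S (P.regColour r) → (ξ j).2 r = (ξ j').2 r := fun r hr =>
    hc.reg_eq x j j' r hrel ⟨γ, hγ, hS.trans hS'.symm, hj, hj', by rwa [hS']⟩
  simp only [Claims, hS, hS', true_and]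
  exact forall_congr' fun r => forall_congr' fun hr => by rw [hreg r hr]

/-- The `x`-edges of a sphere can be followed from every position that claims to be their source. -/
theorem exists_next (hc : P.Consistent I w ξ) (hγ : γ < P.colours) (hα : P.InV S α)
    (hβ' : β < P.colours) (hβ : P.InV S β) (hE : P.Edge S x α β) (h : P.Claims ξ S γ ρ α j) :
    ∃ j', I.rel w x j j' ∧ P.Claims ξ S γ ρ β j' := by
  have hcl := h
  obtain ⟨rfl, rfl, -⟩ := h
  by_cases hex : ∃ j', I.rel w x j j'
  · obtain ⟨j', hrel⟩ := hex
    obtain ⟨h1, -, h3⟩ := hc.link x j j' hrel γ hγ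
    obtain rfl := h1 hα β hβ' hβ hE
    obtain ⟨hS, hj, hj', -⟩ := h3 (.inl ⟨hα, .inl hβ⟩)
    exact ⟨j', hrel, (hc.claims_iff hγ hrel hj hj' rfl hS.symm).1 hcl⟩
  · exact absurd hE (hc.noOut x j hex γ hγ hα β hβ' hβ)

/-- The `x`-edges of a sphere can be followed backwards. -/
theorem exists_prev (hc : P.Consistent I w ξ) (hγ : γ < P.colours) (hα' : α < P.colours)
    (hα : P.InV S α) (hβ : P.InV S β) (hE : P.Edge S x α β) (h : P.Claims ξ S γ ρ β j') :
    ∃ j, I.rel w x j j' ∧ P.Claims ξ S γ ρ α j := by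
  have hcl := h
  obtain ⟨rfl, rfl, -⟩ := h
  by_cases hex : ∃ j, I.rel w x j j'
  · obtain ⟨j, hrel⟩ := hex
    obtain ⟨-, h2, h3⟩ := hc.link x j j' hrel γ hγ
    obtain rfl := h2 hβ α hα' hα hE
    obtain ⟨hS, hj, hj', -⟩ := h3 (.inr ⟨hβ, .inl hα⟩)
    exact ⟨j, hrel, (hc.claims_iff hγ hrel hj hj' hS rfl).2 hcl⟩
  · exact absurd hE (hc.noIn x j' hex γ hγ hβ α hα' hα)

end Consistent

open Classical in
/-- The number of earlier positions that make the same claim. -/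
noncomputable def rank (P : Par) {D : Type*} {w : DataWord (Fin P.a) D P.m}
    (ξ : ConfigSeq (Fin P.states) (Fin P.regs) w) (S γ : ℕ) (ρ : Fin P.regs → Option D)
    (α : ℕ) (j : Fin w.length) : ℕ :=
  (Finset.univ.filter fun i => P.Claims ξ S γ ρ α i ∧ i < j).card

/-- Positions that make the same claim are distinguished by their ranks. -/
theorem eq_of_rank_eq (h : P.Claims ξ S γ ρ α j) (h' : P.Claims ξ S γ ρ α j')
    (hr : P.rank ξ S γ ρ α j = P.rank ξ S γ ρ α j') : j = j' := by
  classical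
  have key : ∀ {j j'}, P.Claims ξ S γ ρ α j → j < j' →
      P.rank ξ S γ ρ α j < P.rank ξ S γ ρ α j' := fun {j j'} h hlt => by
    refine Finset.card_lt_card ⟨fun i hi => ?_, fun hsub => ?_⟩
    · simp only [Finset.mem_filter, Finset.mem_univ, true_and] at hi ⊢
      exact ⟨hi.1, hi.2.trans hlt⟩
    · have := hsub (Finset.mem_filter.2 ⟨Finset.mem_univ j, h, hlt⟩)
      exact absurd (Finset.mem_filter.1 this).2.2 (lt_irrefl _)
  rcases lt_trichotomy j j' with hlt | rfl | hlt
  · exact absurd hr (key h hlt).ne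
  · rfl
  · exact absurd hr (key h' hlt).ne'

namespace Consistent

/-- Following an edge of the sphere is an order isomorphism between the sets of positions that
claim to be its two ends, by monotonicity of the interpretation. Hence it preserves ranks. -/
theorem rank_eq (hc : P.Consistent I w ξ) (hγ : γ < P.colours) (hα' : α < P.colours)
    (hα : P.InV S α) (hβ' : β < P.colours) (hβ : P.InV S β) (hE : P.Edge S x α β)
    (h : P.Claims ξ S γ ρ α j) (h' : P.Claims ξ S γ ρ β j') (hrel : I.rel w x j j') :
    P.rank ξ S γ ρ α j = P.rank ξ S γ ρ β j' := by
  classical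
  apply le_antisymm
  · refine Finset.card_le_card_of_forall_subsingleton (fun i i' => I.rel w x i i') ?_ ?_
    · intro i hi
      simp only [Finset.mem_filter, Finset.mem_univ, true_and] at hi ⊢
      obtain ⟨i', hrel', hi'⟩ := hc.exists_next hγ hα hβ' hβ hE hi.1
      exact ⟨i', ⟨hi', (I.monotone w x i i' j j' hrel' hrel (hc.get_eq hγ hα hi.1 h)
        (hc.get_eq hγ hβ hi' h')).1 hi.2⟩, hrel'⟩
    · intro i' _ i₁ h₁ i₂ h₂
      exact I.in_unique w x _ _ _ h₁.2 h₂.2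
  · refine Finset.card_le_card_of_forall_subsingleton (fun i' i => I.rel w x i i') ?_ ?_
    · intro i' hi'
      simp only [Finset.mem_filter, Finset.mem_univ, true_and] at hi' ⊢
      obtain ⟨i, hrel', hi⟩ := hc.exists_prev hγ hα' hα hβ hE hi'.1
      exact ⟨i, ⟨hi, (I.monotone w x i i' j j' hrel' hrel (hc.get_eq hγ hα hi h)
        (hc.get_eq hγ hβ hi'.1 h')).2 hi'.2⟩, hrel'⟩
    · intro i _ i₁ h₁ i₂ h₂
      exact I.out_unique w x _ _ _ h₁.2 h₂.2

/-- In an accepting run, the graph attached to the state at a position is isomorphic to the sphere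
around this position. -/
theorem iso_sphere (hc : P.Consistent I w ξ) (ha : 0 < P.a) (i₀ : Fin w.length) :
    (P.stateGraph ha (ξ i₀).1).Iso ((I.graph w).sphere P.B i₀) := by
  obtain ⟨q, hq⟩ : ∃ q : ℕ, ((ξ i₀).1 : ℕ) = q := ⟨_, rfl⟩
  obtain ⟨γ, hγ'⟩ : ∃ γ, P.own q = γ := ⟨_, rfl⟩
  obtain ⟨S, hS'⟩ : ∃ S, P.sph q γ = S := ⟨_, rfl⟩
  have hγ : γ < P.colours := hγ' ▸ P.own_lt q
  have hSok : P.SphereOK S γ := by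
    have := hc.sphereOK i₀
    rwa [hq, hγ', hS'] at this
  obtain ⟨hlev0, hcen, hconn, hedges⟩ := id hSok
  have hVγ : P.InV S γ := by rw [InV, hlev0]; exact Nat.zero_le _
  obtain ⟨ρ, hρ⟩ : ∃ ρ, ρ = (ξ i₀).2 := ⟨_, rfl⟩
  -- `Good α j`: the position `j` is the image of the node of colour `α`
  let Good (α : ℕ) (j : Fin w.length) : Prop :=
    P.Claims ξ S γ ρ α j ∧ P.rank ξ S γ ρ α j = P.rank ξ S γ ρ γ i₀
  have good_center : Good γ i₀ :=
    ⟨⟨by rw [hq, hγ'], by rw [hq, hS'], fun r _ => by rw [hρ]⟩, rfl⟩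
  have good_unique : ∀ {α j j'}, Good α j → Good α j' → j = j' := fun h h' =>
    eq_of_rank_eq h.1 h'.1 (h.2.trans h'.2.symm)
  have good_next : ∀ {x : Fin P.s} {α β j}, α < P.colours → P.InV S α → β < P.colours →
      P.InV S β → P.Edge S x α β → Good α j → ∃ j', I.rel w x j j' ∧ Good β j' :=
    fun hα' hα hβ' hβ hE h => by
      obtain ⟨j', hrel, hj'⟩ := hc.exists_next hγ hα hβ' hβ hE h.1
      exact ⟨j', hrel, hj', (hc.rank_eq hγ hα' hα hβ' hβ hE h.1 hj' hrel).symm.trans h.2⟩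
  have good_prev : ∀ {x : Fin P.s} {α β j'}, α < P.colours → P.InV S α → β < P.colours →
      P.InV S β → P.Edge S x α β → Good β j' → ∃ j, I.rel w x j j' ∧ Good α j :=
    fun hα' hα hβ' hβ hE h => by
      obtain ⟨j, hrel, hj⟩ := hc.exists_prev hγ hα' hα hβ hE h.1
      exact ⟨j, hrel, hj, (hc.rank_eq hγ hα' hα hβ' hβ hE hj h.1 hrel).trans h.2⟩
  have good_exists : ∀ d α, α < P.colours → P.InV S α → P.lev S α = d →
      ∃ j, Good α j ∧ (I.graph w).DistLE d i₀ j := by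
    intro d
    induction d with
    | zero =>
      intro α hα' hα hd
      rw [hcen α hα' hα hd]
      exact ⟨i₀, good_center, Dist.refl _ _⟩
    | succ d ih =>
      intro α hα' hα hd
      obtain ⟨β, hβ', hlev, x, hx, hE⟩ := hconn α hα' hα (by omega)
      have hβ : P.InV S β := by unfold InV at hα ⊢; omega
      obtain ⟨j, hj, hdist⟩ := ih β hβ' hβ (by omega)
      rcases hE with hE | hE
      · obtain ⟨i, hrel, hi⟩ := good_prev (x := ⟨x, hx⟩) hα' hα hβ' hβ hE hj
        exact ⟨i, hi, Dist.trans hdist (Dist.symm (Dist.of_edge (G := I.graph w) hrel))⟩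
      · obtain ⟨i, hrel, hi⟩ := good_next (x := ⟨x, hx⟩) hβ' hβ hα' hα hE hj
        exact ⟨i, hi, Dist.trans hdist (Dist.of_edge (G := I.graph w) hrel)⟩
  have good_surj : ∀ d j, d ≤ P.B → (I.graph w).DistLE d i₀ j →
      ∃ α < P.colours, P.InV S α ∧ P.lev S α ≤ d ∧ Good α j := by
    intro d
    induction d with
    | zero =>
      intro j _ hd
      rw [Dist.zero_iff] at hd
      exact ⟨γ, hγ, hVγ, hlev0.le, hd ▸ good_center⟩
    | succ d ih =>
      intro j hdB hd
      rcases Dist.succ_cases hd with hd | ⟨k, x, hd, hrel | hrel⟩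
      · obtain ⟨α, hα', hα, hlev, h⟩ := ih j (by omega) hd
        exact ⟨α, hα', hα, by omega, h⟩
      · obtain ⟨α, hα', hα, hlev, h⟩ := ih k (by omega) hd
        obtain ⟨hk, hkS, -⟩ := id h.1
        have h3 := (hc.link x k j hrel γ hγ).2.2 (.inl ⟨by rwa [hk, hkS],
          .inr (by rw [hk, hkS]; omega)⟩)
        rw [hkS, hk] at h3
        obtain ⟨hjS, -, hact, hE⟩ := h3
        unfold Active at hact
        rw [← hjS] at hact hE
        obtain ⟨j', hrel', hj'⟩ := good_next hα' hα (P.own_lt _) hact hE h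
        obtain rfl := I.out_unique w x _ _ _ hrel hrel'
        have := (hedges x x.2 α hα' hα _ (P.own_lt _) hact hE).1
        exact ⟨_, P.own_lt _, hact, by omega, hj'⟩
      · obtain ⟨α, hα', hα, hlev, h⟩ := ih k (by omega) hd
        obtain ⟨hk, hkS, -⟩ := id h.1
        have h3 := (hc.link x j k hrel γ hγ).2.2 (.inr ⟨by rwa [hk, hkS],
          .inr (by rw [hk, hkS]; omega)⟩)
        rw [hkS, hk] at h3
        obtain ⟨hjS, hact, -, hE⟩ := h3
        unfold Active at hact
        rw [hjS] at hact
        obtain ⟨j', hrel', hj'⟩ := good_prev (P.own_lt _) hact hα' hα hE h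
        obtain rfl := I.in_unique w x _ _ _ hrel hrel'
        have := (hedges x x.2 _ (P.own_lt _) hact α hα' hα hE).2.1
        exact ⟨_, P.own_lt _, hact, by omega, hj'⟩
  have hnode : ∀ u, (P.nodes q).get u < P.colours ∧ P.InV S ((P.nodes q).get u) := fun u => by
    have h := P.mem_nodes.1 ((P.nodes q).get_mem u)
    simpa only [IsNode, hγ', hS', hSok, true_and, not_true, false_and, or_false] using h
  have hex : ∀ u : Fin (P.nodes q).length, ∃ j, Good ((P.nodes q).get u) j ∧
      (I.graph w).DistLE P.B i₀ j := fun u => by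
    obtain ⟨j, hj, hd⟩ := good_exists _ _ (hnode u).1 (hnode u).2 rfl
    exact ⟨j, hj, Dist.mono hd (hnode u).2⟩
  choose pos hpos hposB using hex
  have hbij : Function.Bijective
      (fun u => (⟨pos u, hposB u⟩ : {j // (I.graph w).DistLE P.B i₀ j})) := by
    constructor
    · intro u v huv
      have huv : pos u = pos v := congrArg Subtype.val huv
      refine P.nodes_injective q ?_
      rw [← (hpos u).1.1, ← (hpos v).1.1, huv]
    · rintro ⟨j, hj⟩
      obtain ⟨α, hα', hα, -, h⟩ := good_surj P.B j le_rfl hj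
      have hmem : α ∈ P.nodes q := by
        refine P.mem_nodes.2 ⟨hα', .inl ⟨?_, ?_⟩⟩
        · rwa [hγ', hS']
        · rwa [hγ', hS']
      obtain ⟨u, rfl⟩ := List.get_of_mem hmem
      exact ⟨u, Subtype.ext (good_unique (hpos u) h)⟩
  rw [hq]
  refine ⟨Equiv.ofBijective _ hbij, fun x u v => ?_, fun u => ?_, fun u => ?_, ?_⟩
  · change P.Edge (P.sph q (P.own q)) x _ _ ↔ I.rel w x (pos u) (pos v)
    rw [hγ', hS']
    constructor
    · intro hE
      obtain ⟨j', hrel, hj'⟩ := good_next (hnode u).1 (hnode u).2 (hnode v).1 (hnode v).2 hE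
        (hpos u)
      rwa [good_unique (hpos v) hj']
    · intro hrel
      obtain ⟨hu, huS, -⟩ := (hpos u).1
      obtain ⟨hv, hvS, -⟩ := (hpos v).1
      have h3 := (hc.link x _ _ hrel γ hγ).2.2 (.inl ⟨by rw [hu, huS]; exact (hnode u).2,
          .inl (by rw [hv, huS]; exact (hnode v).2)⟩)
      rw [hu, hv, hvS] at h3
      exact h3.2.2.2
  · apply Fin.ext
    change P.lab (P.sph q (P.own q)) _ % P.a = ((w.get (pos u)).1 : ℕ)
    obtain ⟨hu, huS, -⟩ := (hpos u).1
    have hact : P.Active (ξ (pos u)).1 γ := by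
      rw [Active, hu, huS]
      exact (hnode u).2
    rw [hγ', hS', hc.label, ← (hc.agreeOK _ γ hγ hact).1, huS, hu]
  · obtain ⟨hu, huS, -⟩ := (hpos u).1
    have hact : P.Active (ξ (pos u)).1 γ := by
      rw [Active, hu, huS]
      exact (hnode u).2
    have hcls := (hc.agreeOK _ γ hγ hact).2
    refine Setoid.ext fun k l => ?_
    change P.cls (P.sph q (P.own q)) _ k = P.cls (P.sph q (P.own q)) _ l ↔
      (w.get (pos u)).2 k = (w.get (pos u)).2 l
    rw [← hc.part, ← hcls k k.2, ← hcls l l.2, hγ', hS', huS, hu]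
  · refine Subtype.ext (good_unique (hpos _) ?_)
    change Good ((P.nodes q)[P.centerIndex q]'(P.centerIndex_lt q)) i₀
    rw [P.nodes_centerIndex, hγ']
    exact good_center

end Consistent
end Par
end SphereCRA

namespace SphereCRA

/-! ### Numbers with prescribed digits -/

theorem exists_digits {b : ℕ} (hb : 0 < b) (N : ℕ) (d : ℕ → ℕ) (hd : ∀ i < N, d i < b) :
    ∃ n < b ^ N, ∀ i < N, dig b n i = d i := by
  induction N with
  | zero => exact ⟨0, by simp, fun i hi => absurd hi (Nat.not_lt_zero _)⟩
  | succ N ih =>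
    obtain ⟨n, hn, h⟩ := ih fun i hi => hd i (by omega)
    have hdN := hd N (by omega)
    have hpos : 0 < b ^ N := Nat.pow_pos hb
    refine ⟨n + b ^ N * d N, ?_, fun i hi => ?_⟩
    · have : b ^ N * (d N + 1) ≤ b ^ N * b := Nat.mul_le_mul_left _ hdN
      rw [pow_succ]
      rw [Nat.mul_add] at this
      omega
    · rcases Nat.lt_succ_iff_lt_or_eq.1 hi with hi | rfl
      · rw [← h i hi]
        obtain ⟨e, rfl⟩ := Nat.exists_eq_add_of_lt hi
        unfold dig
        rw [show b ^ (i + e + 1) * d (i + e + 1) = b ^ i * (b * (b ^ e * d (i + e + 1))) by ring,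
          Nat.add_mul_div_left _ _ (Nat.pow_pos hb), Nat.add_mul_mod_self_left]
      · unfold dig
        rw [Nat.add_mul_div_left _ _ hpos, Nat.div_eq_of_lt hn, Nat.zero_add,
          Nat.mod_eq_of_lt hdN]

namespace Par

variable (P : Par)

theorem exists_code_of_fields (lv lb : ℕ → ℕ) (cl ot : ℕ → ℕ → ℕ)
    (hlv : ∀ α, lv α < P.base) (hlb : ∀ α, lb α < P.base) (hcl : ∀ α k, cl α k < P.base)
    (hot : ∀ α x, ot α x < P.base) :
    ∃ S < P.codes, ∀ α < P.colours, P.lev S α = lv α ∧ P.lab S α = lb α ∧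
      (∀ k < P.m, P.cls S α k = cl α k) ∧ ∀ x < P.s, P.out S α x = ot α x := by
  obtain ⟨S, hS, h⟩ := exists_digits P.base_pos (P.colours * P.fields)
    (fun i => if i % P.fields = 0 then lv (i / P.fields)
      else if i % P.fields = 1 then lb (i / P.fields)
      else if i % P.fields < 2 + P.m then cl (i / P.fields) (i % P.fields - 2)
      else ot (i / P.fields) (i % P.fields - (2 + P.m)))
    (fun i _ => by
      split_ifs
      exacts [hlv _, hlb _, hcl _ _, hot _ _])
  have key : ∀ α < P.colours, ∀ e < P.fields, α * P.fields + e < P.colours * P.fields ∧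
      (α * P.fields + e) % P.fields = e ∧ (α * P.fields + e) / P.fields = α := by
    intro α hα e he
    have h1 : (α + 1) * P.fields ≤ P.colours * P.fields := Nat.mul_le_mul_right _ hα
    rw [Nat.add_mul] at h1
    refine ⟨by omega, ?_, ?_⟩
    · rw [Nat.mul_comm, Nat.mul_add_mod, Nat.mod_eq_of_lt he]
    · rw [Nat.mul_comm, Nat.mul_add_div (by omega), Nat.div_eq_of_lt he, Nat.add_zero]
  refine ⟨S, hS, fun α hα => ⟨?_, ?_, fun k hk => ?_, fun x hx => ?_⟩⟩
  · obtain ⟨h1, h2, h3⟩ := key α hα 0 (by unfold fields; omega)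
    have := h _ h1
    rw [h2, h3, if_pos rfl] at this
    exact this
  · obtain ⟨h1, h2, h3⟩ := key α hα 1 (by unfold fields; omega)
    have := h _ h1
    rw [h2, h3, if_neg (by omega), if_pos rfl] at this
    exact this
  · obtain ⟨h1, h2, h3⟩ := key α hα (2 + k) (by unfold fields; omega)
    have := h _ h1
    rw [h2, h3, if_neg (by omega), if_neg (by omega), if_pos (by omega),
      Nat.add_sub_cancel_left] at this
    rw [cls, Nat.add_assoc]
    exact this
  · obtain ⟨h1, h2, h3⟩ := key α hα (2 + P.m + x) (by unfold fields; omega)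
    have := h _ h1
    rw [h2, h3, if_neg (by omega), if_neg (by omega), if_neg (by omega),
      Nat.add_sub_cancel_left] at this
    rw [out, Nat.add_assoc, Nat.add_assoc, ← Nat.add_assoc 2]
    exact this

theorem exists_state {c : ℕ} (hc : c < P.colours) (f : ℕ → ℕ) (hf : ∀ γ, f γ < P.codes) :
    ∃ q < P.states, P.own q = c ∧ ∀ γ < P.colours, P.sph q γ = f γ := by
  obtain ⟨n, hn, h⟩ := exists_digits P.codes_pos P.colours f fun γ _ => hf γ
  have h1 : (c + P.colours * n) / P.colours = n := by
    rw [Nat.add_mul_div_left _ _ P.colours_pos, Nat.div_eq_of_lt hc, Nat.zero_add]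
  refine ⟨c + P.colours * n, ?_, ?_, fun γ hγ => ?_⟩
  · have : P.colours * (n + 1) ≤ P.colours * P.codes ^ P.colours := Nat.mul_le_mul_left _ hn
    rw [Nat.mul_add] at this
    unfold states
    omega
  · rw [own, Nat.add_mul_mod_self_left, Nat.mod_eq_of_lt hc]
  · rw [sph, h1, h γ hγ]

theorem exists_source (f : ℕ → ℕ) (hf : ∀ x < P.s, f x < P.states + 1) :
    ∃ z < P.sources, ∀ x < P.s, P.src z x = f x :=
  exists_digits (Nat.succ_pos _) P.s f hf

end Par

/-! ### Colourings in which nearby positions have different colours -/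

open Classical in
/-- Every position has at most two neighbours for each relation symbol, which bounds the size of
balls. -/
theorem card_ball_le {Λ D : Type*} {s m : ℕ} (I : Signature Λ D (Fin s) m) (w : DataWord Λ D m)
    (r : ℕ) (i : Fin w.length) :
    (Finset.univ.filter fun j => (I.graph w).DistLE r i j).card ≤ (2 * s + 1) ^ r := by
  induction r with
  | zero =>
    simp only [Dist.zero_iff, pow_zero]
    rw [Finset.filter_eq]
    simp
  | succ r ih =>
    rw [pow_succ]
    let nbr (k : Fin w.length) : Finset (Fin w.length) :=
      Finset.univ.biUnion fun x : Fin s => (Finset.univ.filter fun j => I.rel w x k j) ∪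
        Finset.univ.filter fun j => I.rel w x j k
    have hnbr : ∀ k, (nbr k).card ≤ 2 * s := by
      intro k
      refine (Finset.card_biUnion_le_card_mul _ _ 2 fun x _ => ?_).trans (by simp [mul_comm])
      refine (Finset.card_union_le _ _).trans (add_le_add (b := 1) (d := 1) ?_ ?_)
      · refine Finset.card_le_one.2 fun a ha b hb => ?_
        simp only [Finset.mem_filter, Finset.mem_univ, true_and] at ha hb
        exact I.out_unique w x _ _ _ ha hb
      · refine Finset.card_le_one.2 fun a ha b hb => ?_
        simp only [Finset.mem_filter, Finset.mem_univ, true_and] at ha hb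
        exact I.in_unique w x _ _ _ ha hb
    refine (Finset.card_le_card (t := (Finset.univ.filter fun j =>
      (I.graph w).DistLE r i j).biUnion fun k => insert k (nbr k)) fun j hj => ?_).trans
      ((Finset.card_biUnion_le_card_mul _ _ (2 * s + 1) fun k _ =>
        (Finset.card_insert_le _ _).trans (Nat.succ_le_succ (hnbr k))).trans
        (Nat.mul_le_mul_right _ ih))
    simp only [Finset.mem_filter, Finset.mem_univ, true_and, Finset.mem_biUnion,
      Finset.mem_insert, Finset.mem_union, nbr] at hj ⊢
    rcases Dist.succ_cases hj with h | ⟨k, x, h, h' | h'⟩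
    · exact ⟨j, h, .inl rfl⟩
    · exact ⟨k, h, .inr ⟨x, .inl h'⟩⟩
    · exact ⟨k, h, .inr ⟨x, .inr h'⟩⟩

/-- Greedy colouring: if every element is related to at most `C` elements, itself included, then `C`
colours suffice. -/
theorem exists_greedy {n C : ℕ} (R : Fin n → Fin n → Prop) [∀ i, DecidablePred (R i)]
    (hrefl : ∀ i, R i i) (hsymm : ∀ i j, R i j → R j i)
    (hcard : ∀ i, (Finset.univ.filter (R i)).card ≤ C) :
    ∃ col : Fin n → ℕ, (∀ i, col i < C) ∧ ∀ i j, R i j → col i = col j → i = j := by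
  have key : ∀ k ≤ n, ∃ col : Fin n → ℕ, (∀ i : Fin n, i.1 < k → col i < C) ∧
      ∀ i j : Fin n, i.1 < k → j.1 < k → R i j → col i = col j → i = j := by
    intro k
    induction k with
    | zero => exact fun _ => ⟨fun _ => 0, fun i h => absurd h (Nat.not_lt_zero _),
        fun i j h => absurd h (Nat.not_lt_zero _)⟩
    | succ k ih =>
      intro hk
      obtain ⟨col, h1, h2⟩ := ih (by omega)
      let K : Fin n := ⟨k, hk⟩
      have hlt : (((Finset.univ.filter (R K)).erase K).image col).card <
          (Finset.range C).card := by
        refine Finset.card_image_le.trans_lt ?_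
        rw [Finset.card_range]
        exact (Finset.card_erase_lt_of_mem (by simp [hrefl])).trans_le (hcard K)
      obtain ⟨c, hc, hcn⟩ := Finset.exists_mem_notMem_of_card_lt_card hlt
      have hfresh : ∀ j : Fin n, j ≠ K → R K j → col j ≠ c := fun j hj hR he =>
        hcn (Finset.mem_image.2 ⟨j, by simp [hj, hR], he⟩)
      refine ⟨Function.update col K c, fun i hi => ?_, fun i j hi hj hR he => ?_⟩
      · by_cases hiK : i = K
        · rw [hiK, Function.update_self]
          exact Finset.mem_range.1 hc
        · rw [Function.update_of_ne hiK]
          exact h1 i (by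
            have : i.1 ≠ k := fun h => hiK (Fin.ext h)
            omega)
      · by_cases hiK : i = K <;> by_cases hjK : j = K
        · rw [hiK, hjK]
        · subst hiK
          rw [Function.update_self, Function.update_of_ne hjK] at he
          exact absurd he.symm (hfresh j hjK hR)
        · subst hjK
          rw [Function.update_self, Function.update_of_ne hiK] at he
          exact absurd he (hfresh i hiK (hsymm _ _ hR))
        · rw [Function.update_of_ne hiK, Function.update_of_ne hjK] at he
          have hi' : i.1 ≠ k := fun h => hiK (Fin.ext h)
          have hj' : j.1 ≠ k := fun h => hjK (Fin.ext h)
          exact h2 i j (by omega) (by omega) hR he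
  obtain ⟨col, h1, h2⟩ := key n le_rfl
  exact ⟨col, fun i => h1 i i.2, fun i j => h2 i j i.2 j.2⟩

namespace Par

variable {P : Par} {D : Type*} {I : Signature (Fin P.a) D (Fin P.s) P.m}
  {w : DataWord (Fin P.a) D P.m} {col : Fin w.length → ℕ}

/-- A colouring of the positions in which distinct positions at distance at most `4 * B + 1` have
distinct colours. -/
structure Colouring (P : Par) {D : Type*} (I : Signature (Fin P.a) D (Fin P.s) P.m)
    (w : DataWord (Fin P.a) D P.m) (col : Fin w.length → ℕ) : Prop where
  lt : ∀ i, col i < P.colours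
  inj : ∀ i j, (I.graph w).DistLE (4 * P.B + 1) i j → col i = col j → i = j

theorem exists_colouring (I : Signature (Fin P.a) D (Fin P.s) P.m)
    (w : DataWord (Fin P.a) D P.m) : ∃ col, P.Colouring I w col := by
  classical
  obtain ⟨col, h1, h2⟩ := exists_greedy (C := P.colours)
    (fun i j => (I.graph w).DistLE (4 * P.B + 1) i j) (fun i => Dist.refl _ _)
    (fun i j h => Dist.symm h) (fun i => card_ball_le I w _ i)
  exact ⟨col, h1, h2⟩

/-- Two positions of the same colour that are close to a common position are equal. -/
theorem Colouring.eq_of_dist (hcol : P.Colouring I w col) {i j k : Fin w.length} {r t : ℕ}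
    (h : (I.graph w).DistLE r i j) (h' : (I.graph w).DistLE t i k)
    (hrt : r + t ≤ 4 * P.B + 1) (he : col j = col k) : j = k :=
  hcol.inj j k (Dist.mono (Dist.trans (Dist.symm h) h') hrt) he

/-! ### Every data word has an accepting run -/

/-- The distance between two positions in the same component. -/
noncomputable def distance (I : Signature (Fin P.a) D (Fin P.s) P.m)
    (w : DataWord (Fin P.a) D P.m) (i j : Fin w.length) : ℕ :=
  sInf {r | (I.graph w).DistLE r i j}

theorem distance_le {i j : Fin w.length} {r : ℕ} (h : (I.graph w).DistLE r i j) :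
    distance I w i j ≤ r := Nat.sInf_le h

theorem distLE_distance {i j : Fin w.length} {r : ℕ} (h : (I.graph w).DistLE r i j) :
    (I.graph w).DistLE (distance I w i j) i j :=
  Nat.sInf_mem (s := {r | (I.graph w).DistLE r i j}) ⟨r, h⟩

open Classical in
/-- The least index that carries the same data value as `k`. -/
noncomputable def representative (w : DataWord (Fin P.a) D P.m) (i : Fin w.length) (k : ℕ) : ℕ :=
  sInf {l | ∃ (hl : l < P.m) (hk : k < P.m), (w.get i).2 ⟨l, hl⟩ = (w.get i).2 ⟨k, hk⟩}

theorem representative_mem (w : DataWord (Fin P.a) D P.m) (i : Fin w.length) (k : Fin P.m) :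
    ∃ hl : representative w i k < P.m,
      (w.get i).2 ⟨representative w i k, hl⟩ = (w.get i).2 k := by
  obtain ⟨hl, hk, h⟩ := Nat.sInf_mem (s := {l | ∃ (hl : l < P.m) (hk : (k : ℕ) < P.m),
    (w.get i).2 ⟨l, hl⟩ = (w.get i).2 ⟨k, hk⟩}) ⟨k, k.2, k.2, rfl⟩
  exact ⟨hl, h⟩

theorem representative_eq_iff (w : DataWord (Fin P.a) D P.m) (i : Fin w.length)
    (k l : Fin P.m) :
    representative w i k = representative w i l ↔ (w.get i).2 k = (w.get i).2 l := by
  constructor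
  · intro h
    obtain ⟨hk, hk'⟩ := representative_mem w i k
    obtain ⟨hl, hl'⟩ := representative_mem w i l
    have he : (⟨_, hk⟩ : Fin P.m) = ⟨_, hl⟩ := Fin.ext h
    rw [← hk', ← hl', he]
  · intro h
    have hk := k.2
    have hl := l.2
    simp only [representative, Fin.eta, h, hk, hl, exists_true_left]

/-- The number `S` describes the sphere around `p`, with the nodes named by their colours. -/
structure SphereCode (P : Par) {D : Type*} (I : Signature (Fin P.a) D (Fin P.s) P.m)
    (w : DataWord (Fin P.a) D P.m) (col : Fin w.length → ℕ) (p : Fin w.length) (S : ℕ) :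
    Prop where
  lev_eq : ∀ j, (I.graph w).DistLE P.B p j → P.lev S (col j) = distance I w p j
  exists_of_inV : ∀ α < P.colours, P.InV S α → ∃ j, (I.graph w).DistLE P.B p j ∧ col j = α
  lab_eq : ∀ j, (I.graph w).DistLE P.B p j → P.lab S (col j) = (w.get j).1
  cls_eq : ∀ j, (I.graph w).DistLE P.B p j → ∀ k < P.m,
    P.cls S (col j) k = representative w j k
  edge_of_rel : ∀ (x : Fin P.s) j j', (I.graph w).DistLE P.B p j → I.rel w x j j' →
    P.Edge S x (col j) (col j')
  exists_of_edge : ∀ (x : Fin P.s) j β, (I.graph w).DistLE P.B p j → P.Edge S x (col j) β →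
    ∃ j', I.rel w x j j' ∧ col j' = β

theorem exists_sphereCode (hcol : P.Colouring I w col) (p : Fin w.length) :
    ∃ S < P.codes, P.SphereCode I w col p S := by
  classical
  have hex : ∀ α, ∃ (lv lb : ℕ) (cl ot : ℕ → ℕ),
      (lv < P.base ∧ lb < P.base ∧ (∀ k, cl k < P.base) ∧ ∀ x, ot x < P.base) ∧
      ((∀ j, (I.graph w).DistLE P.B p j → col j ≠ α) → lv = P.B + 1) ∧
      ∀ j, (I.graph w).DistLE P.B p j → col j = α →
        lv = distance I w p j ∧ lb = (w.get j).1 ∧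
        (∀ k < P.m, cl k = representative w j k) ∧
        ∀ x : Fin P.s, (∀ j', I.rel w x j j' → ot x = col j' + 1) ∧
          ∀ β, ot x = β + 1 → ∃ j', I.rel w x j j' ∧ col j' = β := by
    intro α
    by_cases h : ∃ j, (I.graph w).DistLE P.B p j ∧ col j = α
    · obtain ⟨j, hj, rfl⟩ := h
      refine ⟨distance I w p j, (w.get j).1, fun k => if k < P.m then representative w j k else 0,
        fun x => if h : ∃ (hx : x < P.s) (j' : _), I.rel w ⟨x, hx⟩ j j' then
          col h.choose_spec.choose + 1 else 0, ⟨?_, ?_, fun k => ?_, fun x => ?_⟩,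
        fun h => absurd rfl (h j hj), fun j₁ hj₁ he => ?_⟩
      · have := distance_le hj
        unfold base
        omega
      · have := (w.get j).1.2
        unfold base
        omega
      · dsimp only
        split
        · rename_i hk
          have : representative w j k < P.m := (representative_mem w j ⟨k, hk⟩).choose
          unfold base
          omega
        · exact P.base_pos
      · dsimp only
        split
        · rename_i h
          have := hcol.lt h.choose_spec.choose
          unfold base
          omega
        · exact P.base_pos
      · obtain rfl := hcol.eq_of_dist hj₁ hj (by omega) he
        refine ⟨rfl, rfl, fun k hk => if_pos hk, fun x => ⟨fun j' hrel => ?_, fun β hβ => ?_⟩⟩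
        · have h : ∃ (hx : x.1 < P.s) (j' : _), I.rel w ⟨x, hx⟩ j₁ j' := ⟨x.2, j', hrel⟩
          refine (dif_pos h).trans ?_
          rw [I.out_unique w x _ _ _ hrel h.choose_spec.choose_spec]
        · dsimp only at hβ
          split at hβ
          · rename_i h
            exact ⟨_, h.choose_spec.choose_spec, Nat.succ_injective hβ⟩
          · omega
    · push Not at h
      refine ⟨P.B + 1, 0, fun _ => 0, fun _ => 0,
        ⟨by unfold base; omega, P.base_pos, fun _ => P.base_pos, fun _ => P.base_pos⟩,
        fun _ => rfl, fun j hj he => absurd he (h j hj)⟩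
  choose lv lb cl ot hb hnone hsome using hex
  obtain ⟨S, hS, hSf⟩ := P.exists_code_of_fields lv lb cl ot (fun α => (hb α).1)
    (fun α => (hb α).2.1) (fun α => (hb α).2.2.1) (fun α => (hb α).2.2.2)
  refine ⟨S, hS, fun j hj => ?_, fun α hα hin => ?_, fun j hj => ?_, fun j hj k hk => ?_,
    fun x j j' hj hrel => ?_, fun x j β hj hE => ?_⟩
  · rw [(hSf _ (hcol.lt j)).1, (hsome _ j hj rfl).1]
  · by_contra hno
    push Not at hno
    rw [InV, (hSf α hα).1, hnone α hno] at hin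
    omega
  · rw [(hSf _ (hcol.lt j)).2.1, (hsome _ j hj rfl).2.1]
  · rw [(hSf _ (hcol.lt j)).2.2.1 k hk, (hsome _ j hj rfl).2.2.1 k hk]
  · rw [Edge, (hSf _ (hcol.lt j)).2.2.2 x x.2]
    exact ((hsome _ j hj rfl).2.2.2 x).1 j' hrel
  · rw [Edge, (hSf _ (hcol.lt j)).2.2.2 x x.2] at hE
    exact ((hsome _ j hj rfl).2.2.2 x).2 β hE

namespace SphereCode

variable {p : Fin w.length} {S : ℕ}

theorem inV (h : P.SphereCode I w col p S) {j : Fin w.length}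
    (hj : (I.graph w).DistLE P.B p j) : P.InV S (col j) := by
  rw [InV, h.lev_eq j hj]
  exact distance_le hj

theorem sphereOK (hcol : P.Colouring I w col) (h : P.SphereCode I w col p S) :
    P.SphereOK S (col p) := by
  refine ⟨?_, fun α hα hin hlev => ?_, fun α hα hin hlev => ?_,
    fun x hx α hα hin β hβ hinβ hE => ?_⟩
  · rw [h.lev_eq p (Dist.refl _ _)]
    exact Nat.le_zero.1 (distance_le (Dist.refl 0 p))
  · obtain ⟨j, hj, rfl⟩ := h.exists_of_inV α hα hin
    rw [h.lev_eq j hj] at hlev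
    have := distLE_distance hj
    rw [hlev, Dist.zero_iff] at this
    rw [this]
  · obtain ⟨j, hj, rfl⟩ := h.exists_of_inV α hα hin
    rw [h.lev_eq j hj] at hlev ⊢
    obtain ⟨d, hd⟩ := Nat.exists_eq_succ_of_ne_zero hlev
    have hdB := distance_le hj
    have hjd := distLE_distance hj
    rw [hd] at hjd
    rcases Dist.succ_cases hjd with hjd | ⟨k, x, hk, hrel⟩
    · have := distance_le hjd
      omega
    · have hkB : (I.graph w).DistLE P.B p k := Dist.mono hk (by omega)
      refine ⟨col k, hcol.lt k, ?_, x, x.2, ?_⟩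
      · rw [h.lev_eq k hkB]
        have h1 := distance_le hk
        have h2 : (I.graph w).DistLE (distance I w p k + 1) p j := by
          refine Dist.trans (distLE_distance hkB) ?_
          rcases hrel with hrel | hrel
          · exact Dist.of_edge hrel
          · exact Dist.symm (Dist.of_edge hrel)
        have := distance_le h2
        omega
      · rcases hrel with hrel | hrel
        · exact .inr (h.edge_of_rel x k j hkB hrel)
        · exact .inl (h.edge_of_rel x j k hj hrel)
  · obtain ⟨j, hj, rfl⟩ := h.exists_of_inV α hα hin
    obtain ⟨k, hk, rfl⟩ := h.exists_of_inV β hβ hinβ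
    obtain ⟨k', hrel, hk'⟩ := h.exists_of_edge ⟨x, hx⟩ j _ hj hE
    have h1 : (I.graph w).DistLE 1 j k' := Dist.of_edge (G := I.graph w) hrel
    obtain rfl := hcol.eq_of_dist (Dist.trans hj h1) hk (by omega) hk'
    rw [h.lev_eq j hj, h.lev_eq k' hk]
    refine ⟨distance_le (Dist.trans (distLE_distance hj) h1),
      distance_le (Dist.trans (distLE_distance hk) (Dist.symm h1)), fun α' hα' hin' hE' => ?_⟩
    obtain ⟨j', hj', rfl⟩ := h.exists_of_inV α' hα' hin'
    obtain ⟨k₂, hrel', hk₂⟩ := h.exists_of_edge ⟨x, hx⟩ j' _ hj' hE'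
    have h2 : (I.graph w).DistLE 1 j' k₂ := Dist.of_edge (G := I.graph w) hrel'
    obtain rfl := hcol.eq_of_dist (Dist.trans hj' h2) hk (by omega) hk₂
    rw [I.in_unique w _ _ _ _ hrel hrel']

end SphereCode

/-- The state `q i` records the spheres of all positions at distance at most `B` from `i`. -/
structure TrueStates (P : Par) {D : Type*} (I : Signature (Fin P.a) D (Fin P.s) P.m)
    (w : DataWord (Fin P.a) D P.m) (col : Fin w.length → ℕ) (Sp q : Fin w.length → ℕ) :
    Prop where
  code : ∀ p, P.SphereCode I w col p (Sp p)
  own_eq : ∀ i, P.own (q i) = col i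
  sph_eq : ∀ i p, (I.graph w).DistLE P.B i p → P.sph (q i) (col p) = Sp p
  exists_of_active : ∀ i, ∀ γ < P.colours, P.Active (q i) γ →
    ∃ p, (I.graph w).DistLE P.B i p ∧ col p = γ

theorem exists_trueStates (hcol : P.Colouring I w col) :
    ∃ Sp q, P.TrueStates I w col Sp q ∧ ∀ i, q i < P.states := by
  classical
  choose Sp hlt hcode using exists_sphereCode hcol
  obtain ⟨E, hE, hEf⟩ := P.exists_code_of_fields (fun _ => P.B + 1) (fun _ => 0) (fun _ _ => 0)
    (fun _ _ => 0) (fun _ => by unfold base; omega) (fun _ => P.base_pos)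
    (fun _ _ => P.base_pos) (fun _ _ => P.base_pos)
  have hex : ∀ i γ, ∃ S < P.codes,
      (∀ p, (I.graph w).DistLE P.B i p → col p = γ → S = Sp p) ∧
      ((¬ ∃ p, (I.graph w).DistLE P.B i p ∧ col p = γ) → S = E) := fun i γ => by
    by_cases h : ∃ p, (I.graph w).DistLE P.B i p ∧ col p = γ
    · obtain ⟨p, hp, rfl⟩ := id h
      exact ⟨Sp p, hlt p, fun p' hp' he => by
        rw [hcol.eq_of_dist hp' hp (by omega) he], fun hn => absurd h hn⟩
    · exact ⟨E, hE, fun p hp he => absurd ⟨p, hp, he⟩ h, fun _ => rfl⟩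
  choose f hf hfp hfE using hex
  choose q hq hown hsph using fun i => P.exists_state (hcol.lt i) (f i) (hf i)
  refine ⟨Sp, q, ⟨hcode, hown, fun i p hp => ?_, fun i γ hγ hact => ?_⟩, hq⟩
  · rw [hsph i _ (hcol.lt p)]
    exact hfp i _ p hp rfl
  · by_contra hno
    rw [Active, hsph i γ hγ, hfE i γ hno, InV, hown, (hEf _ (hcol.lt i)).1] at hact
    omega

namespace TrueStates

variable {Sp q : Fin w.length → ℕ} {i j p : Fin w.length} {x : Fin P.s} {γ α : ℕ}

theorem active (h : P.TrueStates I w col Sp q) (hp : (I.graph w).DistLE P.B i p) :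
    P.Active (q i) (col p) := by
  rw [Active, h.sph_eq i p hp, h.own_eq]
  exact (h.code p).inV (Dist.symm hp)

theorem agreeOK (h : P.TrueStates I w col Sp q) (i : Fin w.length) : P.AgreeOK (q i) := by
  intro γ hγ hact
  obtain ⟨p, hp, rfl⟩ := h.exists_of_active i γ hγ hact
  have hi := Dist.refl (G := I.graph w) P.B i
  rw [h.sph_eq i p hp, h.own_eq, h.sph_eq i i hi, (h.code p).lab_eq i (Dist.symm hp),
    (h.code i).lab_eq i hi]
  refine ⟨rfl, fun k hk => ?_⟩
  rw [(h.code p).cls_eq i (Dist.symm hp) k hk, (h.code i).cls_eq i hi k hk]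

theorem noOut (h : P.TrueStates I w col Sp q) (hno : ¬ ∃ j, I.rel w x i j) :
    P.NoOut (q i) x := by
  intro γ hγ hact β hβ hin hE
  obtain ⟨p, hp, rfl⟩ := h.exists_of_active i γ hγ hact
  rw [h.sph_eq i p hp, h.own_eq] at hE
  obtain ⟨j, hj, -⟩ := (h.code p).exists_of_edge x i β (Dist.symm hp) hE
  exact hno ⟨j, hj⟩

/-- An edge of the sphere around `p` that leads to the colour of a nearby position `i` comes from
an edge of the word that leads to `i`. -/
theorem exists_prev (h : P.TrueStates I w col Sp q) (hcol : P.Colouring I w col)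
    (hp : (I.graph w).DistLE P.B i p) {β : ℕ} (hβ : β < P.colours) (hin : P.InV (Sp p) β)
    (hE : P.Edge (Sp p) x β (col i)) : ∃ j, I.rel w x j i ∧ col j = β := by
  obtain ⟨j, hj, rfl⟩ := (h.code p).exists_of_inV β hβ hin
  obtain ⟨i', hrel, hi'⟩ := (h.code p).exists_of_edge x j _ hj hE
  have h1 : (I.graph w).DistLE 1 j i' := Dist.of_edge (G := I.graph w) hrel
  obtain rfl := hcol.eq_of_dist (Dist.trans hj h1) (Dist.symm hp) (by omega) hi'
  exact ⟨j, hrel, rfl⟩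

theorem noIn (h : P.TrueStates I w col Sp q) (hcol : P.Colouring I w col)
    (hno : ¬ ∃ j, I.rel w x j i) : P.NoIn (q i) x := by
  intro γ hγ hact β hβ hin hE
  obtain ⟨p, hp, rfl⟩ := h.exists_of_active i γ hγ hact
  rw [h.sph_eq i p hp] at hE hin
  rw [h.own_eq] at hE
  obtain ⟨j, hj, -⟩ := h.exists_prev hcol hp hβ hin hE
  exact hno ⟨j, hj⟩

/-- If the sphere around `p` contains `i` and has to contain a neighbour `j` of `i`, then `j` is
in this sphere. -/
theorem dist_of_needs (h : P.TrueStates I w col Sp q) (hcol : P.Colouring I w col)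
    (hp : (I.graph w).DistLE P.B i p) (h1 : (I.graph w).DistLE 1 i j)
    (hn : P.Needs (Sp p) (col i) (col j)) : (I.graph w).DistLE P.B j p := by
  rcases hn.2 with hn | hn
  · obtain ⟨j', hj', he⟩ := (h.code p).exists_of_inV _ (hcol.lt j) hn
    obtain rfl := hcol.eq_of_dist (Dist.trans hp hj') h1 (by omega) he
    exact Dist.symm hj'
  · rw [(h.code p).lev_eq i (Dist.symm hp)] at hn
    exact Dist.symm (Dist.mono (Dist.trans (distLE_distance (Dist.symm hp)) h1) hn)

theorem link (h : P.TrueStates I w col Sp q) (hcol : P.Colouring I w col)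
    (hrel : I.rel w x i j) : P.Link (q i) (q j) x := by
  have h1 : (I.graph w).DistLE 1 i j := Dist.of_edge (G := I.graph w) hrel
  intro γ hγ
  refine ⟨fun hact β hβ hin hE => ?_, fun hact β hβ hin hE => ?_, fun hn => ?_⟩
  · obtain ⟨p, hp, rfl⟩ := h.exists_of_active i γ hγ hact
    rw [h.sph_eq i p hp, h.own_eq] at hE
    obtain ⟨j', hrel', rfl⟩ := (h.code p).exists_of_edge x i β (Dist.symm hp) hE
    rw [h.own_eq, I.out_unique w x _ _ _ hrel hrel']
  · obtain ⟨p, hp, rfl⟩ := h.exists_of_active j γ hγ hact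
    rw [h.sph_eq j p hp] at hE hin
    rw [h.own_eq] at hE
    obtain ⟨i', hrel', rfl⟩ := h.exists_prev hcol hp hβ hin hE
    rw [h.own_eq, I.in_unique w x _ _ _ hrel hrel']
  · have hp : ∃ p, (I.graph w).DistLE P.B i p ∧ (I.graph w).DistLE P.B j p ∧ col p = γ := by
      rcases hn with hn | hn
      · obtain ⟨p, hp, rfl⟩ := h.exists_of_active i γ hγ hn.1
        rw [h.sph_eq i p hp, h.own_eq, h.own_eq] at hn
        exact ⟨p, hp, h.dist_of_needs hcol hp h1 hn, rfl⟩
      · obtain ⟨p, hp, rfl⟩ := h.exists_of_active j γ hγ hn.1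
        rw [h.sph_eq j p hp, h.own_eq, h.own_eq] at hn
        exact ⟨p, h.dist_of_needs hcol hp (Dist.symm h1) hn, hp, rfl⟩
    obtain ⟨p, hi, hj, rfl⟩ := hp
    refine ⟨by rw [h.sph_eq i p hi, h.sph_eq j p hj], h.active hi, h.active hj, ?_⟩
    rw [h.sph_eq j p hj, h.own_eq, h.own_eq]
    exact (h.code p).edge_of_rel x i j (Dist.symm hi) hrel

/-- A node of a sphere that is common to the two ends of an edge is close to both of them, so both
mean the same position by its colour. -/
theorem exists_of_shares (h : P.TrueStates I w col Sp q) (hcol : P.Colouring I w col)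
    (hrel : I.rel w x i j) (hα : α < P.colours) (hs : P.Shares (q i) (q j) α) :
    ∃ k, (I.graph w).DistLE (2 * P.B) i k ∧ (I.graph w).DistLE (2 * P.B) j k ∧ col k = α := by
  have h1 : (I.graph w).DistLE 1 i j := Dist.of_edge (G := I.graph w) hrel
  obtain ⟨γ, hγ, -, hi, hj, hin⟩ := hs
  obtain ⟨p, hp, rfl⟩ := h.exists_of_active j γ hγ hj
  obtain ⟨p', hp', he⟩ := h.exists_of_active i _ hγ hi
  obtain rfl := hcol.eq_of_dist (Dist.trans (Dist.symm h1) hp') hp (by omega) he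
  rw [h.sph_eq j p' hp] at hin
  obtain ⟨k, hk, rfl⟩ := (h.code p').exists_of_inV α hα hin
  exact ⟨k, Dist.mono (Dist.trans hp' hk) (by omega), Dist.mono (Dist.trans hp hk) (by omega),
    rfl⟩

end TrueStates

theorem regColour_lt (r : Fin P.regs) : P.regColour r < P.colours :=
  Nat.div_lt_of_lt_mul (r.2.trans_eq (Nat.mul_comm _ _))

theorem exists_acceptingRun (ha : 0 < P.a) (I : Signature (Fin P.a) D (Fin P.s) P.m)
    (w : DataWord (Fin P.a) D P.m) : ∃ ξ, (P.automaton ha).IsAcceptingRun I w ξ := by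
  classical
  obtain ⟨col, hcol⟩ := exists_colouring I w
  obtain ⟨Sp, q, hq, hqlt⟩ := exists_trueStates hcol
  -- the register of colour `α` holds data of the position of colour `α` in the ball of radius `2B`
  have hreg : ∀ i (r : Fin P.regs), ∃ j, (I.graph w).DistLE (2 * P.B) i j ∧
      ∀ k, (I.graph w).DistLE (2 * P.B) i k → col k = P.regColour r → j = k := fun i r => by
    by_cases h : ∃ k, (I.graph w).DistLE (2 * P.B) i k ∧ col k = P.regColour r
    · obtain ⟨k, hk, he⟩ := h
      exact ⟨k, hk, fun k' hk' he' => hcol.eq_of_dist hk hk' (by omega) (he.trans he'.symm)⟩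
    · exact ⟨i, Dist.refl _ _, fun k hk he => absurd ⟨k, hk, he⟩ h⟩
  choose place hball hplace using hreg
  have hsrc : ∀ i, ∃ z < P.sources, ∀ x : Fin P.s,
      (∀ j, I.rel w x j i → P.src z x = q j + 1) ∧
      ((¬ ∃ j, I.rel w x j i) → P.src z x = 0) := fun i => by
    obtain ⟨z, hz, h⟩ := P.exists_source (fun x =>
      if h : ∃ (hx : x < P.s) (j : _), I.rel w ⟨x, hx⟩ j i then
        q h.choose_spec.choose + 1 else 0) fun x _ => by
          split
          · exact Nat.succ_lt_succ (hqlt _)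
          · exact Nat.succ_pos _
    refine ⟨z, hz, fun x => ⟨fun j hrel => ?_, fun hno => ?_⟩⟩
    · have hex : ∃ (hx : x.1 < P.s) (j : _), I.rel w ⟨x, hx⟩ j i := ⟨x.2, j, hrel⟩
      rw [h x x.2, dif_pos hex, I.in_unique w x _ _ _ hrel hex.choose_spec.choose_spec]
    · rw [h x x.2, dif_neg]
      rintro ⟨_, j, hj⟩
      exact hno ⟨j, hj⟩
  choose z hzlt hz using hsrc
  let ξ : ConfigSeq (Fin P.states) (Fin P.regs) w := fun i =>
    (⟨q i, hqlt i⟩, fun r => some ((w.get (place i r)).2 (P.regIndex r)))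
  have hpred : ∀ i (x : Fin P.s), P.src (z i) x ≠ 0 → ∃ j, I.rel w x j i := fun i x h => by
    by_contra hno
    exact h ((hz i x).2 hno)
  have hown : ∀ i (r : Fin P.regs), P.regColour r = P.own (q i) → place i r = i := fun i r h =>
    hplace i r i (Dist.refl _ _) (by rw [h, hq.own_eq])
  have htracked : ∀ i (x : Fin P.s) (r : Fin P.regs), P.Tracked (z i) (q i) x (P.regColour r) →
      ∃ j, I.rel w x j i ∧ place j r = place i r := fun i x r h => by
    obtain ⟨j, hrel⟩ := hpred i x h.1
    have hs := h.2
    rw [(hz i x).1 j hrel, Nat.add_sub_cancel] at hs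
    obtain ⟨k, hj, hi, he⟩ := hq.exists_of_shares hcol hrel (regColour_lt r) hs
    exact ⟨j, hrel, by rw [hplace j r k hj he, hplace i r k hi he]⟩
  have hi0 := fun i => Dist.refl (G := I.graph w) P.B i
  have hsph : ∀ i, P.sph (q i) (P.own (q i)) = Sp i := fun i => by
    rw [hq.own_eq, hq.sph_eq i i (hi0 i)]
  have hok : ∀ i, P.TransOK (z i) (q i) := fun i => by
    refine ⟨?_, hq.agreeOK i, fun x hx => ⟨fun h0 => ?_, fun h0 => ?_⟩⟩
    · rw [hsph, hq.own_eq]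
      exact (hq.code i).sphereOK hcol
    · refine hq.noIn (x := ⟨x, hx⟩) hcol ?_
      rintro ⟨j, hj⟩
      have := (hz i ⟨x, hx⟩).1 j hj
      simp only at this
      omega
    · obtain ⟨j, hrel⟩ := hpred i ⟨x, hx⟩ h0
      have := (hz i ⟨x, hx⟩).1 j hrel
      simp only at this
      rw [this, Nat.add_sub_cancel]
      exact hq.link (x := ⟨x, hx⟩) hcol hrel
  refine ⟨ξ, fun i => ⟨P.trans ha ⟨q i, hqlt i⟩ (z i), ?_, ?_, rfl, fun x => ⟨fun h => ?_, ?_⟩,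
    fun x j hrel => ?_, ?_, fun r => ?_⟩, fun i x hno => hq.noOut hno, trivial⟩
  · simp only [automaton, List.mem_flatMap, List.mem_map]
    exact ⟨_, List.mem_finRange _, z i, List.mem_range.2 (hzlt i), rfl⟩
  · apply Fin.ext
    change P.lab (P.sph (q i) (P.own (q i))) (P.own (q i)) % P.a = _
    rw [hsph, hq.own_eq, (hq.code i).lab_eq i (hi0 i), Nat.mod_eq_of_lt (w.get i).1.2]
  · refine hpred i x fun h0 => ?_
    change (P.srcMap (z i) x).isSome = true at h
    simp [srcMap, h0] at h
  · rintro ⟨j, hj⟩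
    exact P.srcMap_isSome (by rw [(hz i x).1 j hj]; omega)
  · exact P.srcMap_eq_some.2 ((hz i x).1 j hrel)
  · change (P.guard (z i) (q i)).Eval _
    rw [guard, if_pos (hok i), eval_conj]
    intro φ hφ
    simp only [List.mem_append, List.mem_flatMap, List.mem_map] at hφ
    rcases hφ with ⟨k, -, l, -, rfl⟩ | ⟨x, -, r, -, rfl⟩
    · have hiff := representative_eq_iff w i k l
      rw [← (hq.code i).cls_eq i (hi0 i) k k.2, ← (hq.code i).cls_eq i (hi0 i) l l.2] at hiff
      unfold partFormula
      rw [hsph, hq.own_eq]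
      split
      · rename_i h
        exact ⟨_, hiff.1 h, rfl⟩
      · rename_i h
        rintro ⟨d, h1, h2⟩
        exact h (hiff.2 (h1.trans h2.symm))
    · unfold regFormula
      split
      · rename_i htr
        obtain ⟨j, hrel, hj⟩ := htracked i x r htr
        split
        · rename_i hr
          refine ⟨_, ⟨j, hrel, rfl⟩, ?_⟩
          change _ = (w.get (place j r)).2 _
          rw [hj, hown i r hr]
        · split
          · rename_i hlt
            obtain ⟨j', hrel', hj'⟩ := htracked i ⟨_, hlt⟩ r (P.tracked_carrier hlt)
            refine ⟨_, ⟨j, hrel, rfl⟩, j', hrel', ?_⟩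
            change some ((w.get (place j' r)).2 _) = some ((w.get (place j r)).2 _)
            rw [hj, hj']
          · trivial
      · trivial
  · change UpdateOK I w ξ i (P.update (z i) (q i) r) _
    unfold update
    split
    · rename_i hr
      refine ⟨i, Dist.refl _ _, ?_⟩
      change some ((w.get (place i r)).2 _) = _
      rw [hown i r hr]
    · split
      · rename_i hlt
        obtain ⟨j, hrel, hj⟩ := htracked i ⟨_, hlt⟩ r (P.tracked_carrier hlt)
        refine ⟨j, hrel, ?_⟩
        change some ((w.get (place i r)).2 _) = some ((w.get (place j r)).2 _)
        rw [hj]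
      · exact ⟨place i r, hball i r, rfl⟩

end Par
end SphereCRA

open SphereCRA in
theorem proposition1 :
    ∃ (c : Turing.ToPartrec.Code) (h : ℕ), ∀ (B s a m : ℕ), 0 < a →
      ∃ (nQ nR : ℕ) (A : CRA (Fin a) (Fin s) (Fin nQ) (Fin nR) m)
        (π : Fin nQ → FinPointedGraph (Fin a) (Fin s) m),
        ComputesInTime c [B, s, a, m] (descriptionTokens A π) (tower h (B + s + a + m)) ∧
        nQ ≤ tower h (B + s + a + m) ∧
        nR ≤ tower h (B + s + a + m) ∧
        A.acc = BoolFormula.tru ∧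
        (∀ q : Fin nQ, (π q).2.IsSphere B) ∧
        ∀ (D : Type*) [Infinite D] (I : Signature (Fin a) D (Fin s) m),
          A.language I = Set.univ ∧
          ∀ (w : DataWord (Fin a) D m) (ξ : ConfigSeq (Fin nQ) (Fin nR) w),
            A.IsAcceptingRun I w ξ →
              ∀ i : Fin w.length, (π (ξ i).1).2.Iso ((I.graph w).sphere B i) := by
  obtain ⟨c, h₁, hc⟩ := exists_code
  obtain ⟨h₂, hQ⟩ := exists_bound _ elemPar_id.states
  obtain ⟨h₃, hR⟩ := exists_bound _ elemPar_id.regs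
  refine ⟨c, h₁ + h₂ + h₃, fun B s a m ha => ?_⟩
  let P : Par := ⟨B, s, a, m⟩
  have hle : ∀ h ≤ h₁ + h₂ + h₃, tower h (B + s + a + m) ≤
      tower (h₁ + h₂ + h₃) (B + s + a + m) := fun h hh => tower_le_tower hh _
  refine ⟨P.states, P.regs, P.automaton ha, fun q => ⟨_, P.stateGraph ha q⟩, ?_,
    (hQ P).trans (hle _ (by omega)), (hR P).trans (hle _ (by omega)), rfl,
    fun q => P.isSphere_stateGraph ha q, fun D _ I => ⟨?_, fun w ξ hacc i => ?_⟩⟩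
  · rw [P.descriptionTokens_automaton ha]
    obtain ⟨⟨e, ht⟩⟩ := hc P ha
    exact ⟨⟨e, ht.trans (hle _ (by omega))⟩⟩
  · exact Set.eq_univ_of_forall fun w => Par.exists_acceptingRun (P := P) ha I w
  · exact (Par.Consistent.of_accepting hacc).iso_sphere ha i
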